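/- Let $0<l<\infty$ and let $q\in L^2(0,l)$ be real-valued. For $\lambda\in\mathbb{C}$ let $s_p(\lambda,x)$ ($p=0,1,2$, $x\in[0,l]$) be the fundamental solutions of $iy'''(x)+q(x)y(x)=\lambda^3y(x)$ with initial data $s_p^{(k)}(\lambda,0)=\delta_{kp}$ ($0\le k,p\le2$); explicitly, $s_p(\lambda,\cdot)=\sum_{n\ge0}i^nK_\lambda^n e_p(\lambda,\cdot)$, where $e_p(\lambda,x)=\frac{1}{3(i\lambda)^p}\sum_{\zeta^3=1}\zeta^{-p}e^{i\lambda\zeta x}$ (and $e_p(0,x)=x^p/p!$) and $(K_\lambda f)(x)=\int_0^x e_2(\lambda,x-t)\,q(t)f(t)\,dt$. For $\theta\in\mathbb{C}$ with $|\theta|=1$ let $$\Delta_\theta(q,\lambda)=s_2(\lambda,l)s_1'(\lambda,l)-s_1(\lambda,l)s_2'(\lambda,l)-\theta s_2(\lambda,l)$$ be the characteristic function of the operator $iy'''+qy$ in $L^2(0,l)$ with boundary conditions $y(0)=0$, $y'(l)=\theta y'(0)$, $y(l)=0$. Then $a:=s_2(0,l)\neq0$ (a number that depends only on $q$ and $l$,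 not on $\theta$), and $\theta_0:=\overline{a}/a$ satisfies $|\theta_0|=1$. If $|\theta|=1$ and $\theta+\theta_0\neq0$, then the real zeros of $\Delta_\theta(q,\cdot)$ can be enumerated in ascending order as $\dots<\lambda_{-1}(q,\theta)<\lambda_0(q,\theta)<\lambda_1(q,\theta)<\dots$ (indexed by $\mathbb{Z}$, each real zero listed exactly once, $\lambda_0(q,\theta)$ being the smallest non-negative one), and for every $\lambda\in\mathbb{C}$ $$\Delta_\theta(q,\lambda)=-a(\theta+\theta_0)\prod_{n\in\mathbb{Z}}\left(1-\frac{\lambda^3}{\lambda_n^3(q,\theta)}\right),$$ where the product converges unconditionally. -/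

import Mathlib

noncomputable section

namespace ThirdOrder

open MeasureTheory Complex

/-- The three cube roots of unity `1`, `(-1 + i√3)/2`, `(-1 - i√3)/2`. -/
def zeta : Fin 3 → ℂ :=
  ![1, (-1 + I * (Real.sqrt 3 : ℂ)) / 2, (-1 - I * (Real.sqrt 3 : ℂ)) / 2]

/-- `s_p(z) = (1/3) ∑_k ζ_k^{-p} e^{z ζ_k}`, the analogues of cosine and sine for `y''' = y`. -/
def sFun (p : Fin 3) (z : ℂ) : ℂ :=
  (1 / 3) * ∑ k : Fin 3, (1 / zeta k ^ (p : ℕ)) * exp (z * zeta k)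

/-- The function `s_p(iλx)/(iλ)^p`, entire in `λ`; at `λ = 0` it is understood as its limit
`x^p / p!`. It solves `i y''' = λ³ y`, with the `p`-th initial derivative `1` and the two other
initial data `0`. -/
def freeSol (p : Fin 3) (lam : ℂ) (x : ℝ) : ℂ :=
  if lam = 0 then (x : ℂ) ^ (p : ℕ) / ((p : ℕ).factorial : ℂ)
  else sFun p (I * lam * x) / (I * lam) ^ (p : ℕ)

/-- The Volterra operator `K_λ`, `(K_λ f)(x) = ∫_0^x K₁(λ,x,t) q(t) f(t) dt`, with the kernel
`K₁(λ,x,t) = s_2(iλ(x-t))/(iλ)²`. -/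
def volterra (q : ℝ → ℝ) (lam : ℂ) (f : ℝ → ℂ) (x : ℝ) : ℂ :=
  ∫ t in (0 : ℝ)..x, freeSol 2 lam (x - t) * (q t : ℂ) * f t

/-- The fundamental solutions `s_p(λ,x)` of `i y''' + q y = λ³ y`, with initial data
`s_p^{(k)}(λ,0) = δ_{kp}` (`0 ≤ k, p ≤ 2`): the image of `s_p(iλx)/(iλ)^p` under the
transformation operator `(I - iK_λ)⁻¹ = ∑_{n ≥ 0} iⁿ K_λⁿ`. -/
def fundSol (q : ℝ → ℝ) (p : Fin 3) (lam : ℂ) (x : ℝ) : ℂ :=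
  ∑' n : ℕ, I ^ n * (volterra q lam)^[n] (freeSol p lam) x

/-- `s_p'(λ,l)`, the derivative in `x` at the right end of the interval `[0,l]`. -/
def fundSolDerivEnd (q : ℝ → ℝ) (l : ℝ) (p : Fin 3) (lam : ℂ) : ℂ :=
  derivWithin (fundSol q p lam) (Set.Icc 0 l) l

/-- The characteristic function
`Δ_θ(q,λ) = s_2(λ,l) s_1'(λ,l) - s_1(λ,l) s_2'(λ,l) - θ s_2(λ,l)`, the determinant of the
boundary conditions `y'(l) = θ y'(0)`, `y(l) = 0` on the solutions `y₁ s_1 + y₂ s_2`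
(those with `y(0) = 0`). -/
def charFun (q : ℝ → ℝ) (l : ℝ) (θ lam : ℂ) : ℂ :=
  fundSol q 2 lam l * fundSolDerivEnd q l 1 lam
    - fundSol q 1 lam l * fundSolDerivEnd q l 2 lam
    - θ * fundSol q 2 lam l

/-- `a = s_2(0,l)`. -/
def aConst (q : ℝ → ℝ) (l : ℝ) : ℂ := fundSol q 2 0 l

/-- `θ₀ = ā / a`. -/
def theta0 (q : ℝ → ℝ) (l : ℝ) : ℂ := (starRingEnd ℂ) (aConst q l) / aConst q l

/-- The set of real zeros of `Δ_θ(q,·)`. -/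
def realZeros (q : ℝ → ℝ) (l : ℝ) (θ : ℂ) : Set ℝ := {x : ℝ | charFun q l θ (x : ℂ) = 0}

/-- `… < μ_{-1} < μ_0 < μ_1 < …` enumerates exactly the elements of `S`, and `μ_0` is the
smallest non-negative element of `S`. -/
structure IsAscendingEnumeration (S : Set ℝ) (μ : ℤ → ℝ) : Prop where
  strictMono : StrictMono μ
  range_eq : Set.range μ = S
  isLeast_zero : IsLeast {x | x ∈ S ∧ 0 ≤ x} (μ 0)

end ThirdOrder

end

noncomputable section

namespace ThirdOrder

open MeasureTheory Complex

/-! In the variable $z=\lambda^3$ this is a self-adjoint eigenvalue problem. Put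
$S(z)=s_2(\lambda,l)$. The conjugated Wronskian of $s_1,s_2$ solves the same equation with parameter
$\bar z$ and has the initial data of $s_2$, so $\Delta_\theta=F(z)=-(\overline{S(\bar z)}+\theta
S(z))$. Variation of constants makes $S$ and $F$ entire, and $F(0)=-(\bar a+\theta
a)=-a(\theta+\theta_0)$.

Lagrange's identity controls the zeros. It shows that $S$ does not vanish in the closed upper
half-plane, in particular $a\ne0$. Applied to $y=S(z)s_1-s_1(l)s_2$, it shows that every zero of $F$
is real and simple (`im_eq_zero_of_specFun_eq_zero`, `deriv_specFun_ne_zero`).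

The Volterra series gives $|F(z)|\le B\exp(|z|^{1/3}l)$, so $F$ has order at most $1/3$. Dividing
out the zeros in a disc and applying Borel–Carathéodory to the logarithm of the quotient shows that
$F(z)/F(0)$ is the limit of the products of $1-z/a$ over growing discs (`hadamard_simple_zeros`).
The maximum principle bounds the number of zeros with $|\lambda|\le r$ by $O(1+r)$; the reciprocal
cubes are therefore summable and the product converges unconditionally.

For the indexing by $\mathbb Z$ there must be zeros arbitrarily far out on both half-lines. If one
half-line held only finitely many, comparing the product factor by factor would bound $|F(iy)|$ by a
constant times $|F(\pm y)|$, the sign being that of this half-line. But with $y=\kappa^3$ the left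
side is at least of size $e^{\kappa l}/\kappa^2$ and the right side at most of size $e^{\sqrt3\kappa
l/2}$ (`eventually_specFun_real_lt_imag`, `exists_zero_beyond`). -/

/-! ### Indefinite integrals of integrable functions -/

/-- Fubini's theorem on the triangle `0 < t ≤ s ≤ x`. -/
theorem integral_triangle_swap {F : ℝ → ℝ → ℂ} {x : ℝ} (hx : 0 ≤ x)
    (hF : Integrable (Function.uncurry F)
      ((volume.restrict (Set.Ioc 0 x)).prod (volume.restrict (Set.Ioc 0 x)))) :
    IntervalIntegrable (fun s => ∫ t in (0 : ℝ)..s, F s t) volume 0 x ∧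
    ∫ s in (0 : ℝ)..x, ∫ t in (0 : ℝ)..s, F s t = ∫ t in (0 : ℝ)..x, ∫ s in t..x, F s t := by
  set μ := volume.restrict (Set.Ioc (0 : ℝ) x) with hμ
  set T : Set (ℝ × ℝ) := {p | p.2 ≤ p.1} with hT
  have hTm : MeasurableSet T := measurableSet_le measurable_snd measurable_fst
  have hG : Integrable (T.indicator (Function.uncurry F)) (μ.prod μ) := hF.indicator hTm
  have h1 : ∀ s ∈ Set.Ioc 0 x,
      ∫ t in (0 : ℝ)..s, F s t = ∫ t, T.indicator (Function.uncurry F) (s, t) ∂μ := by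
    intro s hs
    have : (fun t => T.indicator (Function.uncurry F) (s, t))
        = (Set.Iic s).indicator (fun t => F s t) := by
      ext t
      by_cases h : t ≤ s <;> simp [T, Set.indicator, h, Function.uncurry]
    rw [this, integral_indicator measurableSet_Iic, Measure.restrict_restrict measurableSet_Iic,
      intervalIntegral.integral_of_le hs.1.le]
    congr 2
    ext t
    simp only [Set.mem_Ioc, Set.mem_inter_iff, Set.mem_Iic]
    constructor
    · rintro ⟨a, b⟩
      exact ⟨b, a, b.trans hs.2⟩
    · rintro ⟨a, b, c⟩
      exact ⟨b, a⟩
  have h2 : ∀ t ∈ Set.Ioc 0 x,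
      ∫ s in t..x, F s t = ∫ s, T.indicator (Function.uncurry F) (s, t) ∂μ := by
    intro t ht
    have : (fun s => T.indicator (Function.uncurry F) (s, t))
        = (Set.Ici t).indicator (fun s => F s t) := by
      ext s
      by_cases h : t ≤ s <;> simp [T, Set.indicator, h, Function.uncurry]
    rw [this, integral_indicator measurableSet_Ici, Measure.restrict_restrict measurableSet_Ici,
      intervalIntegral.integral_of_le ht.2, ← integral_Icc_eq_integral_Ioc]
    congr 2
    ext s
    simp only [Set.mem_Icc, Set.mem_inter_iff, Set.mem_Ici, Set.mem_Ioc]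
    constructor
    · rintro ⟨a, b⟩
      exact ⟨a, ht.1.trans_le a, b⟩
    · rintro ⟨a, b, c⟩
      exact ⟨a, c⟩
  constructor
  · rw [intervalIntegrable_iff_integrableOn_Ioc_of_le hx]
    refine hG.integral_prod_left.congr ?_
    filter_upwards [ae_restrict_mem measurableSet_Ioc] with s hs
    exact (h1 s hs).symm
  · rw [intervalIntegral.integral_of_le hx, intervalIntegral.integral_of_le hx,
      setIntegral_congr_fun measurableSet_Ioc h1, setIntegral_congr_fun measurableSet_Ioc h2]
    exact integral_integral_swap hG

/-- `f` is, on `[0, l]`, the indefinite integral of the integrable function `f'`. -/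
structure IsPrim (l : ℝ) (f f' : ℝ → ℂ) : Prop where
  integrable : IntervalIntegrable f' volume 0 l
  eq_add_integral : ∀ x ∈ Set.Icc 0 l, f x = f 0 + ∫ t in (0 : ℝ)..x, f' t

namespace IsPrim

variable {l x : ℝ} {f f' g g' : ℝ → ℂ}

theorem intervalIntegrable (h : IsPrim l f f') (hx : x ∈ Set.Icc 0 l) :
    IntervalIntegrable f' volume 0 x :=
  h.integrable.mono_set (by
    rw [Set.uIcc_of_le hx.1, Set.uIcc_of_le (hx.1.trans hx.2)]
    exact Set.Icc_subset_Icc_right hx.2)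

theorem mono (h : IsPrim l f f') (hx : x ∈ Set.Icc 0 l) : IsPrim x f f' :=
  ⟨h.intervalIntegrable hx, fun y hy => h.eq_add_integral y ⟨hy.1, hy.2.trans hx.2⟩⟩

theorem congr_deriv (h : IsPrim l f f') (hl : 0 ≤ l) (hg : ∀ x ∈ Set.Icc 0 l, f' x = g' x) :
    IsPrim l f g' := by
  refine ⟨?_, ?_⟩
  · refine h.integrable.congr fun t ht => hg t ?_
    rw [Set.uIoc_of_le hl] at ht
    exact ⟨ht.1.le, ht.2⟩
  · intro x hx
    rw [h.eq_add_integral x hx]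
    congr 1
    refine intervalIntegral.integral_congr fun t ht => hg t ?_
    rw [Set.uIcc_of_le hx.1] at ht
    exact ⟨ht.1, ht.2.trans hx.2⟩

theorem congr_fun (h : IsPrim l f f') (hl : 0 ≤ l) (hg : ∀ x ∈ Set.Icc 0 l, f x = g x) :
    IsPrim l g f' :=
  ⟨h.integrable, fun x hx => by
    rw [← hg x hx, ← hg 0 ⟨le_rfl, hl⟩, h.eq_add_integral x hx]⟩

theorem continuousOn (h : IsPrim l f f') (hl : 0 ≤ l) : ContinuousOn f (Set.Icc 0 l) := by
  have h1 : ContinuousOn (fun x => f 0 + ∫ t in (0 : ℝ)..x, f' t) (Set.Icc 0 l) := by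
    refine continuousOn_const.add ?_
    have := intervalIntegral.continuousOn_primitive_interval (f := f') (a := 0) (b := l)
      (μ := volume) (by
        rw [Set.uIcc_of_le hl]
        exact (intervalIntegrable_iff_integrableOn_Icc_of_le hl).1 h.integrable)
    rwa [Set.uIcc_of_le hl] at this
  exact h1.congr h.eq_add_integral

theorem hasDerivWithinAt (h : IsPrim l f f') (hc : ContinuousOn f' (Set.Icc 0 l))
    (hx : x ∈ Set.Icc 0 l) : HasDerivWithinAt f (f' x) (Set.Icc 0 l) x := by
  have h1 : HasDerivWithinAt (fun u => ∫ t in (0 : ℝ)..u, f' t) (f' x) (Set.Icc 0 l) x := by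
    have : Fact (x ∈ Set.Icc 0 l) := ⟨hx⟩
    refine intervalIntegral.integral_hasDerivWithinAt_right (h.intervalIntegrable hx)
      (s := Set.Icc 0 l) (t := Set.Icc 0 l) ?_ (hc x hx)
    exact hc.stronglyMeasurableAtFilter_nhdsWithin measurableSet_Icc x
  exact (h1.const_add (f 0)).congr h.eq_add_integral (h.eq_add_integral x hx)

theorem eq_zero_of_eq_zero (h : IsPrim l f f') (hl : 0 < l) (hc : ContinuousOn f' (Set.Icc 0 l))
    (hf : ∀ x ∈ Set.Icc 0 l, f x = 0) (hx : x ∈ Set.Icc 0 l) : f' x = 0 := by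
  have h1 := h.hasDerivWithinAt hc hx
  have h2 : HasDerivWithinAt f 0 (Set.Icc 0 l) x :=
    (hasDerivWithinAt_const x (Set.Icc 0 l) (0 : ℂ)).congr hf (hf x hx)
  exact (uniqueDiffOn_Icc hl x hx).eq_deriv _ h1 h2

theorem add (hf : IsPrim l f f') (hg : IsPrim l g g') :
    IsPrim l (fun x => f x + g x) (fun x => f' x + g' x) :=
  ⟨hf.integrable.add hg.integrable, fun x hx => by
    rw [intervalIntegral.integral_add (hf.intervalIntegrable hx) (hg.intervalIntegrable hx),
      hf.eq_add_integral x hx, hg.eq_add_integral x hx]; ring⟩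

theorem const_mul (hf : IsPrim l f f') (c : ℂ) :
    IsPrim l (fun x => c * f x) (fun x => c * f' x) :=
  ⟨hf.integrable.const_mul c, fun x hx => by
    rw [intervalIntegral.integral_const_mul, hf.eq_add_integral x hx]; ring⟩

theorem sub (hf : IsPrim l f f') (hg : IsPrim l g g') :
    IsPrim l (fun x => f x - g x) (fun x => f' x - g' x) :=
  ⟨hf.integrable.sub hg.integrable, fun x hx => by
    rw [intervalIntegral.integral_sub (hf.intervalIntegrable hx) (hg.intervalIntegrable hx),
      hf.eq_add_integral x hx, hg.eq_add_integral x hx]; ring⟩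

theorem conj (hf : IsPrim l f f') :
    IsPrim l (fun x => (starRingEnd ℂ) (f x)) (fun x => (starRingEnd ℂ) (f' x)) := by
  refine ⟨?_, fun x hx => ?_⟩
  · exact ⟨conjCLE.toContinuousLinearMap.integrable_comp hf.integrable.1,
      conjCLE.toContinuousLinearMap.integrable_comp hf.integrable.2⟩
  · have h : ∫ t in (0 : ℝ)..x, (starRingEnd ℂ) (f' t)
        = (starRingEnd ℂ) (∫ t in (0 : ℝ)..x, f' t) :=
      conjCLE.toContinuousLinearMap.intervalIntegral_comp_comm (hf.intervalIntegrable hx)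
    rw [h, hf.eq_add_integral x hx, map_add]

/-- Reflection `x ↦ l - x` of the interval. -/
theorem reverse (hf : IsPrim l f f') (hl : 0 ≤ l) :
    IsPrim l (fun x => f (l - x)) (fun x => -f' (l - x)) := by
  refine ⟨?_, fun x hx => ?_⟩
  · have := (hf.integrable.comp_sub_left l).neg
    simp only [sub_self, sub_zero] at this
    exact this.symm
  · have hlx : l - x ∈ Set.Icc 0 l := ⟨by linarith [hx.2], by linarith [hx.1]⟩
    rw [hf.eq_add_integral _ hlx, sub_zero, hf.eq_add_integral l ⟨hl, le_rfl⟩,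
      intervalIntegral.integral_neg, intervalIntegral.integral_comp_sub_left (fun t => f' t) l,
      sub_zero, ← intervalIntegral.integral_add_adjacent_intervals (hf.intervalIntegrable hlx)
        ((hf.intervalIntegrable hlx).symm.trans hf.integrable)]
    ring

/-- The product rule for indefinite integrals. -/
theorem mul (hf : IsPrim l f f') (hg : IsPrim l g g') (hl : 0 ≤ l) :
    IsPrim l (fun x => f x * g x) (fun x => f' x * g x + f x * g' x) := by
  have key : ∀ x ∈ Set.Icc 0 l, IntervalIntegrable (fun t => f' t * g t) volume 0 x ∧
      IntervalIntegrable (fun t => f t * g' t) volume 0 x := by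
    intro x hx
    refine ⟨(hf.intervalIntegrable hx).mul_continuousOn ?_,
      (hg.intervalIntegrable hx).continuousOn_mul ?_⟩ <;>
    · rw [Set.uIcc_of_le hx.1]
      first
      | exact (hf.continuousOn hl).mono (Set.Icc_subset_Icc_right hx.2)
      | exact (hg.continuousOn hl).mono (Set.Icc_subset_Icc_right hx.2)
  refine ⟨(key l ⟨hl, le_rfl⟩).1.add (key l ⟨hl, le_rfl⟩).2, fun x hx => ?_⟩
  obtain ⟨i1, i2⟩ := key x hx
  rw [intervalIntegral.integral_add i1 i2]
  have hfx := hf.intervalIntegrable hx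
  have hgx := hg.intervalIntegrable hx
  -- The derivatives are merely integrable, so the formula comes from evaluating the integral of
  -- $g'(s)f'(t)$ over the triangle $t\le s$ in both orders.
  have hprod : Integrable (Function.uncurry fun s t => g' s * f' t)
      ((volume.restrict (Set.Ioc 0 x)).prod (volume.restrict (Set.Ioc 0 x))) :=
    Integrable.mul_prod ((intervalIntegrable_iff_integrableOn_Ioc_of_le hx.1).1 hgx)
      ((intervalIntegrable_iff_integrableOn_Ioc_of_le hx.1).1 hfx)
  have hsw := (integral_triangle_swap hx.1 hprod).2
  have e1 : ∫ s in (0 : ℝ)..x, ∫ t in (0 : ℝ)..s, g' s * f' t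
      = (∫ t in (0 : ℝ)..x, f t * g' t) - f 0 * ∫ t in (0 : ℝ)..x, g' t := by
    rw [← intervalIntegral.integral_const_mul, ← intervalIntegral.integral_sub i2
      (hgx.const_mul _)]
    refine intervalIntegral.integral_congr fun s hs => ?_
    rw [Set.uIcc_of_le hx.1] at hs
    have := hf.eq_add_integral s ⟨hs.1, hs.2.trans hx.2⟩
    simp only [intervalIntegral.integral_const_mul]
    rw [this]
    ring
  have e2 : ∫ t in (0 : ℝ)..x, ∫ s in t..x, g' s * f' t
      = g x * (∫ t in (0 : ℝ)..x, f' t) - ∫ t in (0 : ℝ)..x, f' t * g t := by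
    rw [← intervalIntegral.integral_const_mul, ← intervalIntegral.integral_sub
      (hfx.const_mul _) i1]
    refine intervalIntegral.integral_congr fun s hs => ?_
    rw [Set.uIcc_of_le hx.1] at hs
    have hs' : s ∈ Set.Icc 0 l := ⟨hs.1, hs.2.trans hx.2⟩
    have h1 := hg.eq_add_integral s hs'
    have h2 := hg.eq_add_integral x hx
    have h3 := intervalIntegral.integral_add_adjacent_intervals (hg.intervalIntegrable hs')
        ((hg.intervalIntegrable hs').symm.trans hgx)
    simp only [intervalIntegral.integral_mul_const]
    rw [h1, h2, ← h3]
    ring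
  rw [e1, e2] at hsw
  have h1 := hf.eq_add_integral x hx
  have h2 := hg.eq_add_integral x hx
  have h1' : ∫ t in (0 : ℝ)..x, f' t = f x - f 0 := by rw [h1]; ring
  have h2' : ∫ t in (0 : ℝ)..x, g' t = g x - g 0 := by rw [h2]; ring
  rw [h1', h2'] at hsw
  linear_combination (-1 : ℂ) * hsw

end IsPrim

/-- Differentiation of a convolution `∫_0^x g(x-t) h(t) dt` with integrable `h`. -/
theorem isPrim_convolution {l : ℝ} (hl : 0 ≤ l) {g g' h : ℝ → ℂ}
    (hg : ∀ x, HasDerivAt g (g' x) x) (hg' : Continuous g')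
    (hh : IntervalIntegrable h volume 0 l) :
    IsPrim l (fun x => ∫ t in (0 : ℝ)..x, g (x - t) * h t)
      (fun x => g 0 * h x + ∫ t in (0 : ℝ)..x, g' (x - t) * h t) := by
  have hprod : ∀ x, 0 ≤ x → IntervalIntegrable h volume 0 x →
      Integrable (Function.uncurry fun s t => g' (s - t) * h t)
      ((volume.restrict (Set.Ioc 0 x)).prod (volume.restrict (Set.Ioc 0 x))) := by
    intro x hx hhx
    have hhx' := (intervalIntegrable_iff_integrableOn_Ioc_of_le hx).1 hhx
    have h1 : Integrable (fun p : ℝ × ℝ => (1 : ℂ) * h p.2)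
        ((volume.restrict (Set.Ioc 0 x)).prod (volume.restrict (Set.Ioc 0 x))) :=
      Integrable.mul_prod (integrable_const (1 : ℂ)) hhx'
    -- Integrability is needed on the whole square, where $s-t$ runs through $[-x,x]$.
    obtain ⟨C, hC⟩ := (isCompact_Icc (a := -x) (b := x)).exists_bound_of_continuousOn
      hg'.continuousOn
    have h2 := h1.bdd_mul (c := C) (f := fun p : ℝ × ℝ => g' (p.1 - p.2))
      (by fun_prop) (by
        rw [Measure.prod_restrict]
        filter_upwards [ae_restrict_mem (measurableSet_Ioc.prod measurableSet_Ioc)] with p hp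
        obtain ⟨⟨a, b⟩, ⟨c, d⟩⟩ := hp
        exact hC _ ⟨by linarith, by linarith⟩)
    refine h2.congr (Filter.Eventually.of_forall fun p => ?_)
    simp [Function.uncurry]
  refine ⟨(hh.const_mul _).add (integral_triangle_swap hl (hprod l hl hh)).1, fun x hx => ?_⟩
  have hhx : IntervalIntegrable h volume 0 x := hh.mono_set (by
    rw [Set.uIcc_of_le hx.1, Set.uIcc_of_le (hx.1.trans hx.2)]
    exact Set.Icc_subset_Icc_right hx.2)
  obtain ⟨i1, e1⟩ := integral_triangle_swap hx.1 (hprod x hx.1 hhx)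
  have hcg : Continuous g := continuous_iff_continuousAt.2 fun x => (hg x).continuousAt
  have i2 : IntervalIntegrable (fun t => g (x - t) * h t) volume 0 x :=
    hhx.continuousOn_mul (by fun_prop)
  rw [intervalIntegral.integral_add (hhx.const_mul _) i1, e1,
    intervalIntegral.integral_same, zero_add, intervalIntegral.integral_const_mul]
  have : ∀ t, ∫ s in t..x, g' (s - t) * h t = g (x - t) * h t - g 0 * h t := by
    intro t
    rw [intervalIntegral.integral_mul_const, intervalIntegral.integral_comp_sub_right
      (fun s => g' s), intervalIntegral.integral_eq_sub_of_hasDerivAt (fun y _ => hg y)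
      (hg'.intervalIntegrable _ _), sub_self]
    ring
  simp only [this]
  rw [intervalIntegral.integral_sub i2 (hhx.const_mul _), intervalIntegral.integral_const_mul]
  ring

/-! ### The equation $u'''=cu$: Lagrange's identity and Wronskians -/

/-- `u` solves `u''' = c u` on `[0, l]` in the sense of indefinite integrals, with first and second
derivatives `u1` and `u2`. -/
structure IsSol (c : ℝ → ℂ) (l : ℝ) (u u1 u2 : ℝ → ℂ) : Prop where
  prim : IsPrim l u u1
  prim1 : IsPrim l u1 u2
  prim2 : IsPrim l u2 (fun x => c x * u x)

namespace IsSol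

variable {c d : ℝ → ℂ} {l x : ℝ} {u u1 u2 v v1 v2 : ℝ → ℂ}

theorem mono (h : IsSol c l u u1 u2) (hx : x ∈ Set.Icc 0 l) : IsSol c x u u1 u2 :=
  ⟨h.prim.mono hx, h.prim1.mono hx, h.prim2.mono hx⟩

/-- Lagrange's identity. -/
theorem lagrange (hu : IsSol c l u u1 u2) (hv : IsSol d l v v1 v2) (hl : 0 ≤ l)
    (hx : x ∈ Set.Icc 0 l) :
    u2 x * v x - u1 x * v1 x + u x * v2 x = u2 0 * v 0 - u1 0 * v1 0 + u 0 * v2 0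
      + ∫ t in (0 : ℝ)..x, (c t + d t) * (u t * v t) := by
  have h := ((hu.prim2.mul hv.prim hl).sub (hu.prim1.mul hv.prim1 hl)).add
    (hu.prim.mul hv.prim2 hl)
  rw [h.eq_add_integral x hx]
  congr 1
  refine intervalIntegral.integral_congr fun t _ => ?_
  ring

theorem add (hu : IsSol c l u u1 u2) (hv : IsSol c l v v1 v2) (hl : 0 ≤ l) :
    IsSol c l (fun x => u x + v x) (fun x => u1 x + v1 x) (fun x => u2 x + v2 x) :=
  ⟨hu.prim.add hv.prim, hu.prim1.add hv.prim1,
    (hu.prim2.add hv.prim2).congr_deriv hl fun x _ => by ring⟩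

theorem const_mul (hu : IsSol c l u u1 u2) (hl : 0 ≤ l) (a : ℂ) :
    IsSol c l (fun x => a * u x) (fun x => a * u1 x) (fun x => a * u2 x) :=
  ⟨hu.prim.const_mul a, hu.prim1.const_mul a,
    (hu.prim2.const_mul a).congr_deriv hl fun x _ => by ring⟩

theorem conj (hu : IsSol c l u u1 u2) (hl : 0 ≤ l) :
    IsSol (fun x => (starRingEnd ℂ) (c x)) l (fun x => (starRingEnd ℂ) (u x))
      (fun x => (starRingEnd ℂ) (u1 x)) (fun x => (starRingEnd ℂ) (u2 x)) :=
  ⟨hu.prim.conj, hu.prim1.conj, hu.prim2.conj.congr_deriv hl fun x _ => by rw [map_mul]⟩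

theorem congr_coeff (hu : IsSol c l u u1 u2) (hl : 0 ≤ l) (h : ∀ x ∈ Set.Icc 0 l, c x = d x) :
    IsSol d l u u1 u2 :=
  ⟨hu.prim, hu.prim1, hu.prim2.congr_deriv hl fun x hx => by rw [h x hx]⟩

theorem reverse (hu : IsSol c l u u1 u2) (hl : 0 ≤ l) :
    IsSol (fun x => -c (l - x)) l (fun x => u (l - x)) (fun x => -u1 (l - x))
      (fun x => u2 (l - x)) :=
  ⟨hu.prim.reverse hl,
    (((hu.prim1.reverse hl).const_mul (-1)).congr_fun hl fun x _ => by ring).congr_deriv hl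
      fun x _ => by ring,
    (hu.prim2.reverse hl).congr_deriv hl fun x _ => by ring⟩

/-- The Wronskian of two solutions of `u''' = c u` solves the adjoint equation. -/
theorem wronskian (hu : IsSol c l u u1 u2) (hv : IsSol c l v v1 v2) (hl : 0 ≤ l) :
    IsSol (fun x => -c x) l (fun x => u x * v1 x - v x * u1 x) (fun x => u x * v2 x - v x * u2 x)
      (fun x => u1 x * v2 x - v1 x * u2 x) :=
  ⟨((hu.prim.mul hv.prim1 hl).sub (hv.prim.mul hu.prim1 hl)).congr_deriv hl fun x _ => by ring,
    ((hu.prim.mul hv.prim2 hl).sub (hv.prim.mul hu.prim2 hl)).congr_deriv hl fun x _ => by ring,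
    ((hu.prim1.mul hv.prim2 hl).sub (hv.prim1.mul hu.prim2 hl)).congr_deriv hl
      fun x _ => by ring⟩

theorem continuousOn (hu : IsSol c l u u1 u2) (hl : 0 ≤ l) : ContinuousOn u (Set.Icc 0 l) :=
  hu.prim.continuousOn hl

theorem continuousOn1 (hu : IsSol c l u u1 u2) (hl : 0 ≤ l) : ContinuousOn u1 (Set.Icc 0 l) :=
  hu.prim1.continuousOn hl

theorem continuousOn2 (hu : IsSol c l u u1 u2) (hl : 0 ≤ l) : ContinuousOn u2 (Set.Icc 0 l) :=
  hu.prim2.continuousOn hl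

/-- A solution vanishing identically has vanishing derivatives. -/
theorem derivs_eq_zero (hu : IsSol c l u u1 u2) (hl : 0 < l) (h : ∀ x ∈ Set.Icc 0 l, u x = 0) :
    ∀ x ∈ Set.Icc 0 l, u1 x = 0 ∧ u2 x = 0 := by
  have h1 : ∀ x ∈ Set.Icc 0 l, u1 x = 0 := fun x hx =>
    hu.prim.eq_zero_of_eq_zero hl (hu.continuousOn1 hl.le) h hx
  exact fun x hx =>
    ⟨h1 x hx, hu.prim1.eq_zero_of_eq_zero hl (hu.continuousOn2 hl.le) h1 hx⟩

end IsSol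

/-- Vanishing of the `L²` norm forces a continuous function on `[0, l]` to vanish. -/
theorem eq_zero_of_integral_mul_conj_eq_zero {l : ℝ} (hl : 0 < l) {u : ℝ → ℂ}
    (hu : ContinuousOn u (Set.Icc 0 l))
    (h : ∫ t in (0 : ℝ)..l, u t * (starRingEnd ℂ) (u t) = 0) :
    ∀ x ∈ Set.Icc 0 l, u x = 0 := by
  have h1 : ∫ t in (0 : ℝ)..l, ‖u t‖ ^ 2 = 0 := by
    have : ∀ t, u t * (starRingEnd ℂ) (u t) = ((‖u t‖ ^ 2 : ℝ) : ℂ) := by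
      intro t
      rw [mul_conj, normSq_eq_norm_sq]
    simp only [this] at h
    rw [intervalIntegral.integral_ofReal] at h
    exact_mod_cast h
  by_contra! hne
  obtain ⟨x, hx, hne⟩ := hne
  have : 0 < ∫ t in (0 : ℝ)..l, ‖u t‖ ^ 2 :=
    intervalIntegral.integral_pos hl (by fun_prop) (fun t _ => by positivity)
      ⟨x, hx, by positivity⟩
  linarith

/-! ### Cube roots of unity and the free solutions -/

theorem norm_zeta (k : Fin 3) : ‖zeta k‖ = 1 := by
  have h3 : (Real.sqrt 3) ^ 2 = 3 := Real.sq_sqrt (by norm_num)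
  have : ‖zeta k‖ ^ 2 = 1 := by
    rw [← normSq_eq_norm_sq]
    fin_cases k
    · simp [zeta]
    · simp [zeta, normSq_apply]
      nlinarith
    · simp [zeta, normSq_apply]
      nlinarith
  exact (pow_eq_one_iff_of_nonneg (norm_nonneg _) two_ne_zero).1 this

theorem zeta_ne_zero (k : Fin 3) : zeta k ≠ 0 := by
  rw [← norm_ne_zero_iff, norm_zeta]; norm_num

theorem zeta_pow_three (k : Fin 3) : zeta k ^ 3 = 1 := by
  have h3 : ((Real.sqrt 3 : ℝ) : ℂ) ^ 2 = 3 := by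
    rw [← ofReal_pow, Real.sq_sqrt (by norm_num)]; norm_num
  have hI : I ^ 2 = -1 := I_sq
  fin_cases k
  · simp [zeta]
  · simp only [zeta]
    simp
    linear_combination (norm := ring_nf)
      (1/8 : ℂ) * (I * (√3 : ℂ) - 3) * (-(h3) + (√3 : ℂ) ^ 2 * hI)
  · simp only [zeta]
    simp
    linear_combination (norm := ring_nf)
      (1/8 : ℂ) * (-I * (√3 : ℂ) - 3) * (-(h3) + (√3 : ℂ) ^ 2 * hI)

theorem sum_zeta : ∑ k, zeta k = 0 := by
  simp [Fin.sum_univ_three, zeta]; ring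

theorem sum_inv_zeta : ∑ k, 1 / zeta k = 0 := by
  have : ∀ k, 1 / zeta k = (starRingEnd ℂ) (zeta k) := by
    intro k
    rw [one_div, Complex.inv_def, normSq_eq_norm_sq, norm_zeta]; simp
  simp only [this, ← map_sum, sum_zeta, map_zero]

theorem sum_inv_zeta_sq : ∑ k, 1 / zeta k ^ 2 = 0 := by
  have : ∀ k, 1 / zeta k ^ 2 = zeta k := by
    intro k
    rw [div_eq_iff (pow_ne_zero _ (zeta_ne_zero k)), ← pow_succ', zeta_pow_three]
  simp only [this, sum_zeta]

theorem sFun_zero : sFun 0 0 = 1 ∧ sFun 1 0 = 0 ∧ sFun 2 0 = 0 := by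
  have h1 := sum_inv_zeta
  have h2 := sum_inv_zeta_sq
  refine ⟨by simp [sFun], ?_, ?_⟩
  · simp only [sFun, zero_mul, exp_zero, mul_one]
    simpa using h1
  · simp only [sFun, zero_mul, exp_zero, mul_one]
    simpa using h2

theorem freeSol_initial (lam : ℂ) :
    freeSol 0 lam 0 = 1 ∧ freeSol 1 lam 0 = 0 ∧ freeSol 2 lam 0 = 0 := by
  obtain ⟨h0, h1, h2⟩ := sFun_zero
  by_cases h : lam = 0 <;> simp [freeSol, h, h0, h1, h2]

theorem hasDerivAt_sFun_comp (p : Fin 3) (a : ℂ) (x : ℝ) :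
    HasDerivAt (fun x : ℝ => sFun p (a * x))
      ((1 / 3) * ∑ k : Fin 3, (1 / zeta k ^ (p : ℕ)) * (exp (a * x * zeta k) * (a * zeta k))) x := by
  unfold sFun
  refine HasDerivAt.const_mul _ (HasDerivAt.fun_sum fun k _ => HasDerivAt.const_mul _ ?_)
  have h1 : HasDerivAt (fun x : ℝ => a * (x : ℂ) * zeta k) (a * zeta k) x := by
    simpa using ((ofRealCLM.hasDerivAt (x := x)).const_mul a).mul_const (zeta k)
  exact h1.cexp

theorem hasDerivAt_freeSol_two (lam : ℂ) (x : ℝ) :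
    HasDerivAt (freeSol 2 lam) (freeSol 1 lam x) x := by
  by_cases h : lam = 0
  · have h1 : freeSol 2 lam = fun x : ℝ => (x : ℂ) ^ 2 / 2 := by ext; simp [freeSol, h]
    have h2 : freeSol 1 lam x = (x : ℂ) := by simp [freeSol, h]
    rw [h1, h2]
    have := ((ofRealCLM.hasDerivAt (x := x)).pow 2).div_const 2
    simpa using this
  · have h1 : freeSol 2 lam = fun x : ℝ => sFun 2 (I * lam * x) / (I * lam) ^ 2 := by
      ext; simp [freeSol, h]
    rw [h1]
    convert! (hasDerivAt_sFun_comp 2 (I * lam) x).div_const ((I * lam) ^ 2) using 1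
    have hI : I * lam ≠ 0 := mul_ne_zero I_ne_zero h
    simp only [freeSol, h, if_false, sFun]
    simp only [Fin.val_one, Fin.val_two]
    have z0 := zeta_ne_zero 0
    have z1 := zeta_ne_zero 1
    have z2 := zeta_ne_zero 2
    simp only [Fin.sum_univ_three]
    field_simp

theorem hasDerivAt_freeSol_one (lam : ℂ) (x : ℝ) :
    HasDerivAt (freeSol 1 lam) (freeSol 0 lam x) x := by
  by_cases h : lam = 0
  · have h1 : freeSol 1 lam = fun x : ℝ => (x : ℂ) := by ext; simp [freeSol, h]
    have h2 : freeSol 0 lam x = 1 := by simp [freeSol, h]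
    rw [h1, h2]
    simpa using (hasDerivAt_id x).ofReal_comp
  · have h1 : freeSol 1 lam = fun x : ℝ => sFun 1 (I * lam * x) / (I * lam) ^ 1 := by
      ext; simp [freeSol, h]
    rw [h1]
    convert! (hasDerivAt_sFun_comp 1 (I * lam) x).div_const ((I * lam) ^ 1) using 1
    have hI : I * lam ≠ 0 := mul_ne_zero I_ne_zero h
    simp only [freeSol, h, if_false, sFun]
    simp only [Fin.val_one, Fin.val_zero]
    have z0 := zeta_ne_zero 0
    have z1 := zeta_ne_zero 1
    have z2 := zeta_ne_zero 2
    simp only [Fin.sum_univ_three]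
    field_simp

/-- Differentiation multiplies each exponential by $i\lambda\zeta$, and $\zeta=\zeta^{-2}$ leads
from index 0 back to index 2. This closes the cycle of the three free solutions. -/
theorem hasDerivAt_freeSol_zero (lam : ℂ) (x : ℝ) :
    HasDerivAt (freeSol 0 lam) ((I * lam) ^ 3 * freeSol 2 lam x) x := by
  by_cases h : lam = 0
  · have h1 : freeSol 0 lam = fun x : ℝ => 1 := by ext; simp [freeSol, h]
    rw [h1, h]
    simpa using hasDerivAt_const x (1 : ℂ)
  · have h1 : freeSol 0 lam = fun x : ℝ => sFun 0 (I * lam * x) := by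
      ext; simp [freeSol, h]
    rw [h1]
    convert! hasDerivAt_sFun_comp 0 (I * lam) x using 1
    have hI : I * lam ≠ 0 := mul_ne_zero I_ne_zero h
    simp only [freeSol, h, if_false, sFun]
    simp only [Fin.val_two, Fin.val_zero]
    have z : ∀ k, 1 / zeta k ^ 2 = zeta k := fun k => by
      rw [div_eq_iff (pow_ne_zero _ (zeta_ne_zero k)), ← pow_succ', zeta_pow_three]
    simp only [z, Fin.sum_univ_three]
    field_simp

theorem continuous_freeSol (p : Fin 3) (lam : ℂ) : Continuous (freeSol p lam) := by
  fin_cases p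
  · exact continuous_iff_continuousAt.2 fun x => (hasDerivAt_freeSol_zero lam x).continuousAt
  · exact continuous_iff_continuousAt.2 fun x => (hasDerivAt_freeSol_one lam x).continuousAt
  · exact continuous_iff_continuousAt.2 fun x => (hasDerivAt_freeSol_two lam x).continuousAt

theorem norm_sFun_le (p : Fin 3) (a : ℂ) {x τ : ℝ} (hx : 0 ≤ x)
    (hτ : ∀ k, (a * zeta k).re ≤ τ) : ‖sFun p (a * x)‖ ≤ Real.exp (τ * x) := by
  unfold sFun
  rw [norm_mul]
  have : ‖∑ k : Fin 3, (1 / zeta k ^ (p : ℕ)) * exp (a * x * zeta k)‖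
      ≤ ∑ k : Fin 3, Real.exp (τ * x) := by
    refine norm_sum_le_of_le _ fun k _ => ?_
    rw [norm_mul, norm_div, norm_pow, norm_zeta, norm_exp]
    simp only [norm_one, one_pow, div_one, one_mul]
    refine Real.exp_le_exp.2 ?_
    have : a * x * zeta k = (x : ℂ) * (a * zeta k) := by ring
    rw [this, re_ofReal_mul, mul_comm]
    exact mul_le_mul_of_nonneg_right (hτ k) hx
  simp only [Finset.sum_const, Finset.card_univ, Fintype.card_fin, nsmul_eq_mul] at this
  have h3 : ‖(1 / 3 : ℂ)‖ = 1 / 3 := by norm_num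
  rw [h3]
  push_cast at this
  linarith

/-- Keeps both the decay $|\lambda|^{-p}$ and the true largest exponent $\tau$, which the comparison
of growth on the real and imaginary axes relies on. -/
theorem norm_freeSol_le (p : Fin 3) {lam : ℂ} (h : lam ≠ 0) {x τ : ℝ} (hx : 0 ≤ x)
    (hτ : ∀ k, (I * lam * zeta k).re ≤ τ) :
    ‖freeSol p lam x‖ ≤ (‖lam‖ ^ (p : ℕ))⁻¹ * Real.exp (τ * x) := by
  simp only [freeSol, h, if_false, norm_div, norm_pow, norm_mul, norm_I, one_mul]
  rw [div_eq_inv_mul]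
  exact mul_le_mul_of_nonneg_left (norm_sFun_le p _ hx hτ) (by positivity)

theorem norm_freeSol_zero_le (lam : ℂ) {x : ℝ} (hx : 0 ≤ x) :
    ‖freeSol 0 lam x‖ ≤ Real.exp (‖lam‖ * x) := by
  by_cases h : lam = 0
  · simp [freeSol, h]
  · have := norm_freeSol_le 0 h hx (τ := ‖lam‖) (fun k => by
      refine (re_le_norm _).trans ?_
      simp [norm_zeta])
    simpa using this

/-- Integrating a bound of the derivative costs only a factor $x$. Bounds for $e_1$ and $e_2$ thus
follow from the one for $e_0$ without dividing by $\lambda$, and stay uniform near $\lambda=0$. -/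
theorem norm_le_mul_exp_of_hasDerivAt {g g' : ℝ → ℂ} {B τ : ℝ} (hB : 0 ≤ B) (hτ : 0 ≤ τ)
    (hg : ∀ x, HasDerivAt g (g' x) x) (hc : Continuous g') (h0 : g 0 = 0) {x : ℝ} (hx : 0 ≤ x)
    (hb : ∀ t ∈ Set.Icc 0 x, ‖g' t‖ ≤ B * Real.exp (τ * t)) :
    ‖g x‖ ≤ x * B * Real.exp (τ * x) := by
  have h1 : g x = ∫ t in (0 : ℝ)..x, g' t := by
    rw [intervalIntegral.integral_eq_sub_of_hasDerivAt (fun y _ => hg y)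
      (hc.intervalIntegrable _ _), h0, sub_zero]
  rw [h1]
  have := intervalIntegral.norm_integral_le_of_norm_le_const (a := 0) (b := x) (f := g')
    (C := B * Real.exp (τ * x)) (fun t ht => by
      rw [Set.uIoc_of_le hx] at ht
      refine (hb t ⟨ht.1.le, ht.2⟩).trans ?_
      gcongr
      exact ht.2)
  rw [sub_zero, abs_of_nonneg hx] at this
  linarith

theorem norm_freeSol_one_le (lam : ℂ) {x : ℝ} (hx : 0 ≤ x) :
    ‖freeSol 1 lam x‖ ≤ x * Real.exp (‖lam‖ * x) := by
  have := norm_le_mul_exp_of_hasDerivAt zero_le_one (norm_nonneg lam) (hasDerivAt_freeSol_one lam)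
    (continuous_freeSol 0 lam) (freeSol_initial lam).2.1 hx
    (fun t ht => by simpa using norm_freeSol_zero_le lam ht.1)
  simpa using this

theorem norm_freeSol_two_le (lam : ℂ) {x : ℝ} (hx : 0 ≤ x) :
    ‖freeSol 2 lam x‖ ≤ x * x * Real.exp (‖lam‖ * x) := by
  refine norm_le_mul_exp_of_hasDerivAt hx (norm_nonneg lam) (hasDerivAt_freeSol_two lam)
    (continuous_freeSol 1 lam) (freeSol_initial lam).2.2 hx fun t ht => ?_
  refine (norm_freeSol_one_le lam ht.1).trans ?_
  gcongr
  exact ht.2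

/-- A bound valid for all `p` and `λ`, uniformly on `[0, l]`. -/
theorem norm_freeSol_le_of_mem_Icc (p : Fin 3) (lam : ℂ) {x l : ℝ} (hx : x ∈ Set.Icc 0 l) :
    ‖freeSol p lam x‖ ≤ (1 + l) ^ 2 * Real.exp (‖lam‖ * x) := by
  have hl : 0 ≤ l := hx.1.trans hx.2
  have e := (Real.exp_pos (‖lam‖ * x)).le
  fin_cases p
  · refine (norm_freeSol_zero_le lam hx.1).trans (le_mul_of_one_le_left e ?_)
    nlinarith
  · refine (norm_freeSol_one_le lam hx.1).trans (mul_le_mul_of_nonneg_right ?_ e)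
    nlinarith [hx.2]
  · refine (norm_freeSol_two_le lam hx.1).trans (mul_le_mul_of_nonneg_right ?_ e)
    nlinarith [hx.1, hx.2, mul_le_mul hx.2 hx.2 hx.1 hl]

/-! ### The Volterra operator and its Neumann series -/

section

theorem intervalIntegrable_of_memLp {q : ℝ → ℝ} {l : ℝ} (hl : 0 ≤ l)
    (hq : MemLp q 2 (volume.restrict (Set.Ioo 0 l))) :
    IntervalIntegrable q volume 0 l ∧ IntervalIntegrable (fun t => q t ^ 2) volume 0 l := by
  rw [intervalIntegrable_iff_integrableOn_Ioo_of_le hl,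
    intervalIntegrable_iff_integrableOn_Ioo_of_le hl]
  exact ⟨hq.integrable (by norm_num), hq.integrable_sq⟩

/-- Exponentially weighted integrals of an `L²` function decay in the weight. -/
theorem exists_integral_abs_mul_exp_le {q : ℝ → ℝ} {l : ℝ} (hl : 0 ≤ l)
    (hq : MemLp q 2 (volume.restrict (Set.Ioo 0 l))) :
    ∃ Q : ℝ, 0 < Q ∧ ∀ M : ℝ, 0 < M → ∀ x ∈ Set.Icc 0 l,
      ∫ t in (0 : ℝ)..x, |q t| * Real.exp (-(M * (x - t))) ≤ Q / √M := by
  obtain ⟨h1, h2⟩ := intervalIntegrable_of_memLp hl hq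
  have hI : 0 ≤ ∫ t in (0 : ℝ)..l, q t ^ 2 :=
    intervalIntegral.integral_nonneg hl fun t _ => sq_nonneg _
  -- From $|q|E\le q^2/(2\sqrt M)+\sqrt M E^2/2$ with $E=e^{-M(x-t)}$, and $\int E^2\le 1/(2M)$.
  refine ⟨(∫ t in (0 : ℝ)..l, q t ^ 2) / 2 + 1 / 4, by positivity, fun M hM x hx => ?_⟩
  have hsub : Set.uIcc 0 x ⊆ Set.uIcc 0 l := by
    rw [Set.uIcc_of_le hx.1, Set.uIcc_of_le hl]
    exact Set.Icc_subset_Icc_right hx.2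
  have h1x := h1.mono_set hsub
  have h2x := h2.mono_set hsub
  have hs : 0 < √M := Real.sqrt_pos.2 hM
  have hss : √M * √M = M := Real.mul_self_sqrt hM.le
  have hexp : Continuous fun t : ℝ => Real.exp (-(2 * M * (x - t))) := by fun_prop
  have hmono : ∫ t in (0 : ℝ)..x, |q t| * Real.exp (-(M * (x - t)))
      ≤ ∫ t in (0 : ℝ)..x, (1 / (2 * √M) * q t ^ 2
        + √M / 2 * Real.exp (-(2 * M * (x - t)))) := by
    refine intervalIntegral.integral_mono_on hx.1 ?_ ?_ ?_
    · exact h1x.abs.mul_continuousOn (by fun_prop)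
    · exact (h2x.const_mul _).add ((hexp.intervalIntegrable _ _).const_mul _)
    · intro t _
      have e : Real.exp (-(2 * M * (x - t))) = Real.exp (-(M * (x - t))) ^ 2 := by
        rw [← Real.exp_nat_mul]; congr 1; push_cast; ring
      rw [e]
      set E := Real.exp (-(M * (x - t)))
      have : 1 / (2 * √M) * q t ^ 2 + √M / 2 * E ^ 2 - |q t| * E
          = (|q t| - √M * E) ^ 2 / (2 * √M) := by
        field_simp
        rw [← sq_abs (q t)]
        ring
      have h0 : 0 ≤ (|q t| - √M * E) ^ 2 / (2 * √M) := by positivity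
      linarith
  refine hmono.trans ?_
  rw [intervalIntegral.integral_add (h2x.const_mul _) ((hexp.intervalIntegrable _ _).const_mul _),
    intervalIntegral.integral_const_mul, intervalIntegral.integral_const_mul]
  have e1 : ∫ t in (0 : ℝ)..x, q t ^ 2 ≤ ∫ t in (0 : ℝ)..l, q t ^ 2 :=
    intervalIntegral.integral_mono_interval le_rfl hx.1 hx.2
      (Filter.Eventually.of_forall fun t => sq_nonneg _) h2
  have e2 : ∫ t in (0 : ℝ)..x, Real.exp (-(2 * M * (x - t))) ≤ 1 / (2 * M) := by
    have hd : ∀ t, HasDerivAt (fun t => Real.exp (-(2 * M * (x - t))) / (2 * M))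
        (Real.exp (-(2 * M * (x - t)))) t := by
      intro t
      have := (((((hasDerivAt_id t).const_sub x).const_mul (2 * M)).neg).exp).div_const (2 * M)
      convert! this using 1
      simp only [id, Pi.neg_apply]
      field_simp
    rw [intervalIntegral.integral_eq_sub_of_hasDerivAt (fun t _ => hd t)
      (hexp.intervalIntegrable _ _)]
    simp only [sub_self, mul_zero, neg_zero, Real.exp_zero]
    have : 0 ≤ Real.exp (-(2 * M * (x - 0))) / (2 * M) := by positivity
    linarith
  calc _ ≤ 1 / (2 * √M) * (∫ t in (0 : ℝ)..l, q t ^ 2) + √M / 2 * (1 / (2 * M)) := by gcongr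
    _ = _ := by
      have : √M / M = 1 / √M := by
        rw [div_eq_div_iff hM.ne' hs.ne', one_mul, hss]
      rw [show √M / 2 * (1 / (2 * M)) = √M / M * (1 / 4) by field_simp; norm_num, this]
      field_simp

variable {q : ℝ → ℝ} {l : ℝ}

theorem intervalIntegrable_ofReal {a b : ℝ} (hq : IntervalIntegrable q volume a b) :
    IntervalIntegrable (fun t => (q t : ℂ)) volume a b :=
  ⟨Integrable.ofReal hq.1, Integrable.ofReal hq.2⟩

theorem intervalIntegrable_mul_of_continuousOn {f : ℝ → ℂ} {x : ℝ}
    (hq : IntervalIntegrable q volume 0 l) (hf : ContinuousOn f (Set.Icc 0 l))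
    (hx : x ∈ Set.Icc 0 l) :
    IntervalIntegrable (fun t => (q t : ℂ) * f t) volume 0 x := by
  have hsub : Set.uIcc 0 x ⊆ Set.uIcc 0 l := by
    rw [Set.uIcc_of_le hx.1, Set.uIcc_of_le (hx.1.trans hx.2)]
    exact Set.Icc_subset_Icc_right hx.2
  refine IntervalIntegrable.mul_continuousOn ?_ (hf.mono ?_)
  · exact intervalIntegrable_ofReal (hq.mono_set hsub)
  · rw [Set.uIcc_of_le hx.1]
    exact Set.Icc_subset_Icc_right hx.2

theorem volterra_eq (lam : ℂ) (f : ℝ → ℂ) (x : ℝ) :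
    volterra q lam f x = ∫ t in (0 : ℝ)..x, freeSol 2 lam (x - t) * ((q t : ℂ) * f t) := by
  simp only [volterra, mul_assoc]

theorem isPrim_volterra (hl : 0 ≤ l) (hq : IntervalIntegrable q volume 0 l) (lam : ℂ) {f : ℝ → ℂ}
    (hf : ContinuousOn f (Set.Icc 0 l)) :
    IsPrim l (volterra q lam f)
      (fun x => ∫ t in (0 : ℝ)..x, freeSol 1 lam (x - t) * ((q t : ℂ) * f t)) := by
  have h := isPrim_convolution hl (hasDerivAt_freeSol_two lam) (continuous_freeSol 1 lam)
    (intervalIntegrable_mul_of_continuousOn hq hf ⟨hl, le_rfl⟩)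
  refine (h.congr_fun hl fun x _ => (volterra_eq lam f x).symm).congr_deriv hl fun x _ => ?_
  simp [(freeSol_initial lam).2.2]

/-- Since $e^{\tau(x-t)}e^{(\tau+M)t}=e^{(\tau+M)x}e^{-M(x-t)}$, the surplus weight $M$ turns into
damping of $q$. In the norm with weight $e^{(\tau+M)x}$ the operator has norm at most $CQ$, which
can be made small. -/
theorem norm_volterra_le {lam : ℂ} {C τ M A Q x : ℝ} {f : ℝ → ℂ}
    (hq : IntervalIntegrable q volume 0 l)
    (hQ : ∀ x ∈ Set.Icc 0 l, ∫ t in (0 : ℝ)..x, |q t| * Real.exp (-(M * (x - t))) ≤ Q)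
    (hA0 : 0 ≤ A) (hC0 : 0 ≤ C)
    (hC : ∀ x ∈ Set.Icc 0 l, ‖freeSol 2 lam x‖ ≤ C * Real.exp (τ * x))
    (hA : ∀ x ∈ Set.Icc 0 l, ‖f x‖ ≤ A * Real.exp ((τ + M) * x)) (hx : x ∈ Set.Icc 0 l) :
    ‖volterra q lam f x‖ ≤ A * (C * Q) * Real.exp ((τ + M) * x) := by
  have hsub : Set.uIcc 0 x ⊆ Set.uIcc 0 l := by
    rw [Set.uIcc_of_le hx.1, Set.uIcc_of_le (hx.1.trans hx.2)]
    exact Set.Icc_subset_Icc_right hx.2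
  have hqx := hq.mono_set hsub
  have h1 : ‖volterra q lam f x‖ ≤ ∫ t in (0 : ℝ)..x,
      (A * C * Real.exp ((τ + M) * x)) * (|q t| * Real.exp (-(M * (x - t)))) := by
    unfold volterra
    refine intervalIntegral.norm_integral_le_of_norm_le hx.1 ?_ ?_
    · refine Filter.Eventually.of_forall fun t ht => ?_
      have ht' : t ∈ Set.Icc 0 l := ⟨ht.1.le, ht.2.trans hx.2⟩
      have hxt : x - t ∈ Set.Icc 0 l := ⟨by linarith [ht.2], by linarith [ht.1, hx.2]⟩
      rw [norm_mul, norm_mul, norm_real, Real.norm_eq_abs]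
      calc _ ≤ (C * Real.exp (τ * (x - t))) * |q t| * (A * Real.exp ((τ + M) * t)) := by
            gcongr
            · exact hC _ hxt
            · exact hA _ ht'
        _ = A * C * |q t| * (Real.exp (τ * (x - t)) * Real.exp ((τ + M) * t)) := by ring
        _ = A * C * |q t| * (Real.exp ((τ + M) * x) * Real.exp (-(M * (x - t)))) := by
            rw [← Real.exp_add, ← Real.exp_add]; ring_nf
        _ = _ := by ring
    · exact (hqx.abs.mul_continuousOn (by fun_prop)).const_mul _
  refine h1.trans ?_
  rw [intervalIntegral.integral_const_mul]
  calc _ ≤ (A * C * Real.exp ((τ + M) * x)) * Q := by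
        gcongr
        exact hQ x hx
    _ = _ := by ring

/-- Geometric bounds for the iterates of the Volterra operator. -/
theorem iterate_volterra_bound {lam : ℂ} {C τ M A Q : ℝ} (p : Fin 3) (hl : 0 ≤ l)
    (hq : IntervalIntegrable q volume 0 l)
    (hQ : ∀ x ∈ Set.Icc 0 l, ∫ t in (0 : ℝ)..x, |q t| * Real.exp (-(M * (x - t))) ≤ Q)
    (hQ0 : 0 ≤ Q) (hM : 0 ≤ M) (hA0 : 0 ≤ A) (hC0 : 0 ≤ C)
    (hC : ∀ x ∈ Set.Icc 0 l, ‖freeSol 2 lam x‖ ≤ C * Real.exp (τ * x))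
    (hA : ∀ x ∈ Set.Icc 0 l, ‖freeSol p lam x‖ ≤ A * Real.exp (τ * x)) (n : ℕ) :
    ContinuousOn ((volterra q lam)^[n] (freeSol p lam)) (Set.Icc 0 l) ∧
    ∀ x ∈ Set.Icc 0 l, ‖(volterra q lam)^[n] (freeSol p lam) x‖
      ≤ A * (C * Q) ^ n * Real.exp ((τ + M) * x) := by
  induction n with
  | zero =>
    refine ⟨(continuous_freeSol p lam).continuousOn, fun x hx => ?_⟩
    refine (hA x hx).trans ?_
    rw [pow_zero, mul_one]
    have := mul_nonneg hM hx.1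
    exact mul_le_mul_of_nonneg_left (Real.exp_le_exp.2 (by linarith)) hA0
  | succ n ih =>
    rw [Function.iterate_succ_apply']
    refine ⟨(isPrim_volterra hl hq lam ih.1).continuousOn hl, fun x hx => ?_⟩
    have := norm_volterra_le hq hQ (by positivity) hC0 hC ih.2 hx
    rw [pow_succ, ← mul_assoc]
    exact this

/-- The series defining the fundamental solution solves the Volterra integral equation. -/
theorem fundSol_volterra {lam : ℂ} {C τ M A Q : ℝ} (p : Fin 3) (hl : 0 ≤ l)
    (hq : IntervalIntegrable q volume 0 l)
    (hQ : ∀ x ∈ Set.Icc 0 l, ∫ t in (0 : ℝ)..x, |q t| * Real.exp (-(M * (x - t))) ≤ Q)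
    (hQ0 : 0 ≤ Q) (hM : 0 ≤ M) (hA0 : 0 ≤ A) (hC0 : 0 ≤ C) (hτ : 0 ≤ τ)
    (hC : ∀ x ∈ Set.Icc 0 l, ‖freeSol 2 lam x‖ ≤ C * Real.exp (τ * x))
    (hA : ∀ x ∈ Set.Icc 0 l, ‖freeSol p lam x‖ ≤ A * Real.exp (τ * x)) (hr : C * Q < 1) :
    ContinuousOn (fundSol q p lam) (Set.Icc 0 l) ∧
    ∀ x ∈ Set.Icc 0 l,
      fundSol q p lam x = freeSol p lam x + I * volterra q lam (fundSol q p lam) x ∧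
      ‖fundSol q p lam x‖ ≤ A * (1 - C * Q)⁻¹ * Real.exp ((τ + M) * x) := by
  have hb := iterate_volterra_bound p hl hq hQ hQ0 hM hA0 hC0 hC hA
  have hr0 : 0 ≤ C * Q := mul_nonneg hC0 hQ0
  have hgeo := summable_geometric_of_lt_one hr0 hr
  have hnorm : ∀ n, ∀ x ∈ Set.Icc 0 l, ‖I ^ n * (volterra q lam)^[n] (freeSol p lam) x‖
      ≤ A * (C * Q) ^ n * Real.exp ((τ + M) * x) := by
    intro n x hx
    rw [norm_mul, norm_pow, norm_I, one_pow, one_mul]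
    exact (hb n).2 x hx
  have hsum : ∀ y, Summable fun n : ℕ => A * (C * Q) ^ n * Real.exp ((τ + M) * y) :=
    fun y => (hgeo.mul_left A).mul_right _
  have hS : ∀ x ∈ Set.Icc 0 l,
      Summable fun n => I ^ n * (volterra q lam)^[n] (freeSol p lam) x :=
    fun x hx => Summable.of_norm_bounded (hsum x) fun n => hnorm n x hx
  have hexpmono : ∀ x ∈ Set.Icc 0 l, Real.exp ((τ + M) * x) ≤ Real.exp ((τ + M) * l) := by
    intro x hx
    gcongr
    exact hx.2
  have hcont : ContinuousOn (fundSol q p lam) (Set.Icc 0 l) := by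
    refine continuousOn_tsum (fun n => continuousOn_const.mul (hb n).1) (hsum l) fun n x hx => ?_
    refine (hnorm n x hx).trans ?_
    exact mul_le_mul_of_nonneg_left (hexpmono x hx) (by positivity)
  refine ⟨hcont, fun x hx => ⟨?_, ?_⟩⟩
  · have h1 : fundSol q p lam x = freeSol p lam x
        + ∑' n : ℕ, I ^ (n + 1) * (volterra q lam)^[n + 1] (freeSol p lam) x := by
      rw [fundSol, (hS x hx).tsum_eq_zero_add]
      simp
    rw [h1]
    congr 1
    have hqx : IntervalIntegrable q volume 0 x := hq.mono_set (by
      rw [Set.uIcc_of_le hx.1, Set.uIcc_of_le hl]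
      exact Set.Icc_subset_Icc_right hx.2)
    have hqC : IntervalIntegrable (fun t => (q t : ℂ)) volume 0 x := intervalIntegrable_ofReal hqx
    have hcf : Continuous fun t : ℝ => freeSol 2 lam (x - t) :=
      (continuous_freeSol 2 lam).comp (by fun_prop)
    -- Termwise integration is justified by the geometric majorant; applying $iK_\lambda$ then
    -- shifts the series by one index.
    have hd : HasSum (fun n : ℕ => ∫ t in (0 : ℝ)..x, freeSol 2 lam (x - t) * (q t : ℂ)
          * (I ^ n * (volterra q lam)^[n] (freeSol p lam) t))
        (∫ t in (0 : ℝ)..x, freeSol 2 lam (x - t) * (q t : ℂ) * fundSol q p lam t) := by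
      refine intervalIntegral.hasSum_integral_of_dominated_convergence
        (fun n t => ‖freeSol 2 lam (x - t) * (q t : ℂ)‖
          * (A * (C * Q) ^ n * Real.exp ((τ + M) * l))) ?_ ?_ ?_ ?_ ?_
      · intro n
        rw [Set.uIoc_of_le hx.1]
        refine AEStronglyMeasurable.mul ?_ ?_
        · exact hcf.aestronglyMeasurable.mul hqC.1.aestronglyMeasurable
        · refine ContinuousOn.aestronglyMeasurable ?_ measurableSet_Ioc
          refine (continuousOn_const.mul (hb n).1).mono fun t ht => ?_
          exact ⟨ht.1.le, ht.2.trans hx.2⟩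
      · intro n
        refine Filter.Eventually.of_forall fun t ht => ?_
        rw [Set.uIoc_of_le hx.1] at ht
        have ht' : t ∈ Set.Icc 0 l := ⟨ht.1.le, ht.2.trans hx.2⟩
        rw [norm_mul]
        refine mul_le_mul_of_nonneg_left ?_ (norm_nonneg _)
        refine (hnorm n t ht').trans ?_
        exact mul_le_mul_of_nonneg_left (hexpmono t ht') (by positivity)
      · exact Filter.Eventually.of_forall fun t _ => (hsum l).mul_left _
      · simp only [tsum_mul_left]
        exact ((hqC.continuousOn_mul hcf.continuousOn).norm).mul_const _
      · refine Filter.Eventually.of_forall fun t ht => ?_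
        rw [Set.uIoc_of_le hx.1] at ht
        have ht' : t ∈ Set.Icc 0 l := ⟨ht.1.le, ht.2.trans hx.2⟩
        exact (hS t ht').hasSum.mul_left _
    rw [volterra, ← (hd.mul_left I).tsum_eq]
    congr 1
    ext n
    rw [Function.iterate_succ_apply', volterra, ← intervalIntegral.integral_const_mul,
      ← intervalIntegral.integral_const_mul]
    refine intervalIntegral.integral_congr fun t _ => ?_
    ring
  · refine (norm_tsum_le_tsum_norm ?_).trans ?_
    · exact Summable.of_nonneg_of_le (fun _ => norm_nonneg _) (fun n => hnorm n x hx) (hsum x)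
    · have h2 : ∑' n : ℕ, A * (C * Q) ^ n * Real.exp ((τ + M) * x)
          = A * (1 - C * Q)⁻¹ * Real.exp ((τ + M) * x) := by
        rw [tsum_mul_right, tsum_mul_left, tsum_geometric_of_lt_one hr0 hr]
      rw [← h2]
      exact Summable.tsum_le_tsum (fun n => hnorm n x hx)
        (Summable.of_nonneg_of_le (fun _ => norm_nonneg _) (fun n => hnorm n x hx) (hsum x))
        (hsum x)

end

/-! ### The differential equation and analytic dependence on the spectral parameter -/

section

/-- The coefficient of the equation `i y''' + q y = z y`, written as `y''' = c y`. -/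
def coeff (q : ℝ → ℝ) (z : ℂ) (x : ℝ) : ℂ := -I * (z - q x)

variable {q : ℝ → ℝ} {l : ℝ}

/-- A solution of the Volterra equation solves the differential equation. -/
theorem isSol_of_volterra (hl : 0 ≤ l) (hq : IntervalIntegrable q volume 0 l) {lam : ℂ}
    {e e1 e2 u : ℝ → ℂ} (h : ∀ x, HasDerivAt e (e1 x) x) (h1 : ∀ x, HasDerivAt e1 (e2 x) x)
    (h2 : ∀ x, HasDerivAt e2 ((I * lam) ^ 3 * e x) x) (hu : ContinuousOn u (Set.Icc 0 l))
    (heq : ∀ x ∈ Set.Icc 0 l, u x = e x + I * volterra q lam u x) :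
    ∃ u1 u2, IsSol (coeff q (lam ^ 3)) l u u1 u2 ∧ u 0 = e 0 ∧ u1 0 = e1 0 ∧ u2 0 = e2 0 := by
  have hqu := intervalIntegrable_mul_of_continuousOn hq hu ⟨hl, le_rfl⟩
  have cont : ∀ {g g' : ℝ → ℂ}, (∀ x, HasDerivAt g (g' x) x) → Continuous g := fun hg =>
    continuous_iff_continuousAt.2 fun x => (hg x).continuousAt
  have prim : ∀ {g g' : ℝ → ℂ}, (∀ x, HasDerivAt g (g' x) x) → Continuous g' → IsPrim l g g' := by
    intro g g' hg hc
    refine ⟨hc.intervalIntegrable _ _, fun x _ => ?_⟩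
    rw [intervalIntegral.integral_eq_sub_of_hasDerivAt (fun y _ => hg y)
      (hc.intervalIntegrable _ _)]
    ring
  obtain ⟨i0, i1, i2⟩ := freeSol_initial lam
  -- The boundary terms of the three differentiations carry $e_2(0)=0$, $e_1(0)=0$ and $e_0(0)=1$;
  -- only the last survives and produces the potential term.
  have p0 := (prim h (cont h1)).add ((isPrim_volterra hl hq lam hu).const_mul I)
  have p1 := (prim h1 (cont h2)).add ((isPrim_convolution hl (hasDerivAt_freeSol_one lam)
    (continuous_freeSol 0 lam) hqu).const_mul I)
  have p2 := (prim h2 ((cont h).const_mul _)).add ((isPrim_convolution hl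
    (hasDerivAt_freeSol_zero lam) ((continuous_freeSol 2 lam).const_mul _) hqu).const_mul I)
  refine ⟨_, _, ⟨p0.congr_fun hl fun x hx => (heq x hx).symm,
    p1.congr_deriv hl (g' := fun x => e2 x + I * ∫ t in (0 : ℝ)..x,
      freeSol 0 lam (x - t) * ((q t : ℂ) * u t)) fun x _ => ?_,
    p2.congr_deriv hl fun x hx => ?_⟩, ?_, ?_, ?_⟩
  · simp [i1]
  · rw [heq x hx, volterra_eq]
    have : ∫ t in (0 : ℝ)..x, (I * lam) ^ 3 * freeSol 2 lam (x - t) * ((q t : ℂ) * u t)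
        = (I * lam) ^ 3 * ∫ t in (0 : ℝ)..x, freeSol 2 lam (x - t) * ((q t : ℂ) * u t) := by
      rw [← intervalIntegral.integral_const_mul]
      refine intervalIntegral.integral_congr fun t _ => ?_
      ring
    rw [this, i0, coeff]
    linear_combination (I * lam ^ 3 * (e x + I * ∫ t in (0 : ℝ)..x,
      freeSol 2 lam (x - t) * ((q t : ℂ) * u t))) * I_sq
  · rw [heq 0 ⟨le_rfl, hl⟩]; simp [volterra]
  · simp
  · simp

/-- Uniform bounds for the fundamental solutions, together with the Volterra equation. -/
theorem exists_fundSol_bound (hl : 0 ≤ l) (hq : MemLp q 2 (volume.restrict (Set.Ioo 0 l))) :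
    ∃ B : ℝ, 0 < B ∧ ∀ (p : Fin 3) (lam : ℂ),
      ContinuousOn (fundSol q p lam) (Set.Icc 0 l) ∧ ∀ x ∈ Set.Icc 0 l,
        fundSol q p lam x = freeSol p lam x + I * volterra q lam (fundSol q p lam) x ∧
        ‖fundSol q p lam x‖ ≤ B * Real.exp (‖lam‖ * l) := by
  obtain ⟨Q, hQ0, hQ⟩ := exists_integral_abs_mul_exp_le hl hq
  set C : ℝ := (1 + l) ^ 2 with hC
  have hC0 : 0 < C := by positivity
  -- Chosen so that the contraction constant $CQ/\sqrt M$ is $1/2$.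
  set M : ℝ := (2 * C * Q) ^ 2 with hM
  have hM0 : 0 < M := by positivity
  have hsq : √M = 2 * C * Q := Real.sqrt_sq (by positivity)
  have hr : C * (Q / √M) = 1 / 2 := by rw [hsq]; field_simp
  refine ⟨C * 2 * Real.exp (M * l), by positivity, fun p lam => ?_⟩
  have key := fundSol_volterra (lam := lam) (C := C) (τ := ‖lam‖) (M := M) (A := C) (Q := Q / √M)
    p hl (intervalIntegrable_of_memLp hl hq).1 (hQ M hM0) (by positivity) hM0.le hC0.le hC0.le
    (norm_nonneg _) (fun x hx => norm_freeSol_le_of_mem_Icc 2 lam hx)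
    (fun x hx => norm_freeSol_le_of_mem_Icc p lam hx) (by rw [hr]; norm_num)
  refine ⟨key.1, fun x hx => ⟨(key.2 x hx).1, (key.2 x hx).2.trans ?_⟩⟩
  rw [hr]
  have : Real.exp ((‖lam‖ + M) * x) ≤ Real.exp (M * l) * Real.exp (‖lam‖ * l) := by
    rw [← Real.exp_add]
    refine Real.exp_le_exp.2 ?_
    have := mul_le_mul_of_nonneg_left hx.2 (add_nonneg (norm_nonneg lam) hM0.le)
    linarith
  calc _ ≤ C * (1 - 1 / 2)⁻¹ * (Real.exp (M * l) * Real.exp (‖lam‖ * l)) := by gcongr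
    _ = _ := by norm_num; ring

theorem fundSol_two_isSol (hl : 0 ≤ l) (hq : MemLp q 2 (volume.restrict (Set.Ioo 0 l)))
    (lam : ℂ) : ∃ u1 u2, IsSol (coeff q (lam ^ 3)) l (fundSol q 2 lam) u1 u2 ∧
      fundSol q 2 lam 0 = 0 ∧ u1 0 = 0 ∧ u2 0 = 1 := by
  obtain ⟨B, -, hB⟩ := exists_fundSol_bound hl hq
  obtain ⟨u1, u2, hs, h0, h1, h2⟩ := isSol_of_volterra hl (intervalIntegrable_of_memLp hl hq).1
    (hasDerivAt_freeSol_two lam) (hasDerivAt_freeSol_one lam) (hasDerivAt_freeSol_zero lam)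
    (hB 2 lam).1 (fun x hx => ((hB 2 lam).2 x hx).1)
  obtain ⟨i0, i1, i2⟩ := freeSol_initial lam
  exact ⟨u1, u2, hs, h0.trans i2, h1.trans i1, h2.trans i0⟩

theorem fundSol_one_isSol (hl : 0 ≤ l) (hq : MemLp q 2 (volume.restrict (Set.Ioo 0 l)))
    (lam : ℂ) : ∃ u1 u2, IsSol (coeff q (lam ^ 3)) l (fundSol q 1 lam) u1 u2 ∧
      fundSol q 1 lam 0 = 0 ∧ u1 0 = 1 ∧ u2 0 = 0 := by
  obtain ⟨B, -, hB⟩ := exists_fundSol_bound hl hq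
  obtain ⟨u1, u2, hs, h0, h1, h2⟩ := isSol_of_volterra hl (intervalIntegrable_of_memLp hl hq).1
    (hasDerivAt_freeSol_one lam) (hasDerivAt_freeSol_zero lam)
    (e2 := fun x => (I * lam) ^ 3 * freeSol 2 lam x)
    (fun x => (hasDerivAt_freeSol_two lam x).const_mul _)
    (hB 1 lam).1 (fun x hx => ((hB 1 lam).2 x hx).1)
  obtain ⟨i0, i1, i2⟩ := freeSol_initial lam
  exact ⟨u1, u2, hs, h0.trans i1, h1.trans i0, by rw [h2, i2, mul_zero]⟩

theorem fundSolDerivEnd_eq (hl : 0 < l) {p : Fin 3} {lam : ℂ} {c u1 u2 : ℝ → ℂ}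
    (h : IsSol c l (fundSol q p lam) u1 u2) : fundSolDerivEnd q l p lam = u1 l :=
  (h.prim.hasDerivWithinAt (h.continuousOn1 hl.le) ⟨hl.le, le_rfl⟩).derivWithin
    (uniqueDiffOn_Icc hl l ⟨hl.le, le_rfl⟩)

/-- The principal cube root. -/
def cbrt (z : ℂ) : ℂ := z ^ (1 / 3 : ℂ)

theorem cbrt_pow_three (z : ℂ) : cbrt z ^ 3 = z := by
  rw [cbrt, ← cpow_nat_mul]
  norm_num

theorem norm_cbrt (z : ℂ) : ‖cbrt z‖ = ‖z‖ ^ (1 / 3 : ℝ) := by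
  have h : ‖cbrt z‖ ^ 3 = ‖z‖ := by rw [← norm_pow, cbrt_pow_three]
  rw [← h, ← Real.rpow_natCast, ← Real.rpow_mul (norm_nonneg _)]
  norm_num

/-- The reflected potential drives the solution that starts at $x$ and runs backwards, used as the
kernel in variation of constants. -/
theorem memLp_reverse (hq : MemLp q 2 (volume.restrict (Set.Ioo 0 l))) {x : ℝ}
    (hx : x ≤ l) : MemLp (fun t => q (x - t)) 2 (volume.restrict (Set.Ioo 0 x)) := by
  have h1 : MemLp q 2 (volume.restrict (Set.Ioo 0 x)) :=
    hq.mono_measure (Measure.restrict_mono (Set.Ioo_subset_Ioo_right hx) le_rfl)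
  have h2 := (Measure.measurePreserving_sub_left (volume : Measure ℝ) x).restrict_preimage
    (measurableSet_Ioo (a := 0) (b := x))
  have h3 : (fun t => x - t) ⁻¹' Set.Ioo 0 x = Set.Ioo 0 x := by
    ext t
    simp only [Set.mem_preimage, Set.mem_Ioo]
    constructor <;> rintro ⟨a, b⟩ <;> constructor <;> linarith
  rw [h3] at h2
  exact h1.comp_measurePreserving h2

/-- Variation of constants: the value at `x` of any solution for the spectral parameter `z`, in
terms of a kernel that belongs to the parameter `w`. -/
theorem exists_variation_of_constants (hq : MemLp q 2 (volume.restrict (Set.Ioo 0 l))) {x : ℝ}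
    (hx : x ∈ Set.Icc 0 l) (w : ℂ) :
    ∃ (k : ℝ → ℂ) (a0 a1 a2 : ℂ), ContinuousOn k (Set.Icc 0 x) ∧
      ∀ (z : ℂ) (u u1 u2 : ℝ → ℂ), IsSol (coeff q z) l u u1 u2 →
        u x = a0 * u 0 + a1 * u1 0 + a2 * u2 0 - I * (z - w) * ∫ t in (0 : ℝ)..x, u t * k t := by
  -- Reflection changes the sign of the coefficient, so $t\mapsto s(x-t)$ solves the adjoint
  -- equation with parameter $w$. Its data at $t=x$ are $0,0,1$, and the left side of Lagrange's
  -- identity there is just $u(x)$.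
  obtain ⟨s1, s2, hs, h0, h1, h2⟩ := fundSol_two_isSol hx.1 (memLp_reverse hq hx.2) (cbrt w)
  set s := fundSol (fun t => q (x - t)) 2 (cbrt w)
  have hr := hs.reverse hx.1
  refine ⟨fun t => s (x - t), s2 x, s1 x, s x, hr.continuousOn hx.1, fun z u u1 u2 hu => ?_⟩
  have hL := (hu.mono hx).lagrange hr hx.1 ⟨hx.1, le_rfl⟩
  simp only [sub_self, sub_zero, h0, h1, h2] at hL
  have : ∫ t in (0 : ℝ)..x, (coeff q z t
        + -coeff (fun t => q (x - t)) (cbrt w ^ 3) (x - t)) * (u t * s (x - t))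
      = -(I * (z - w)) * ∫ t in (0 : ℝ)..x, u t * s (x - t) := by
    rw [← intervalIntegral.integral_const_mul]
    refine intervalIntegral.integral_congr fun t _ => ?_
    simp only [coeff, cbrt_pow_three, sub_sub_cancel]
    ring
  rw [this] at hL
  linear_combination hL

/-- Uniqueness for the initial value problem. -/
theorem IsSol.eq_of_initial (hq : MemLp q 2 (volume.restrict (Set.Ioo 0 l)))
    {z : ℂ} {u u1 u2 v v1 v2 : ℝ → ℂ} (hu : IsSol (coeff q z) l u u1 u2)
    (hv : IsSol (coeff q z) l v v1 v2) (h0 : u 0 = v 0) (h1 : u1 0 = v1 0) (h2 : u2 0 = v2 0)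
    {x : ℝ} (hx : x ∈ Set.Icc 0 l) : u x = v x := by
  -- With $w=z$ the integral term drops out and only the initial data remain.
  obtain ⟨k, a0, a1, a2, -, hk⟩ := exists_variation_of_constants hq hx z
  rw [hk z u u1 u2 hu, hk z v v1 v2 hv, h0, h1, h2]
  simp

/-- The fundamental solutions as functions of the spectral parameter `z = λ³`. -/
def specSol (q : ℝ → ℝ) (p : Fin 3) (z : ℂ) (x : ℝ) : ℂ := fundSol q p (cbrt z) x

theorem specSol_two_isSol (hl : 0 ≤ l) (hq : MemLp q 2 (volume.restrict (Set.Ioo 0 l)))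
    (z : ℂ) : ∃ u1 u2, IsSol (coeff q z) l (specSol q 2 z) u1 u2 ∧
      specSol q 2 z 0 = 0 ∧ u1 0 = 0 ∧ u2 0 = 1 := by
  have := fundSol_two_isSol hl hq (cbrt z)
  rwa [cbrt_pow_three] at this

theorem specSol_one_isSol (hl : 0 ≤ l) (hq : MemLp q 2 (volume.restrict (Set.Ioo 0 l)))
    (z : ℂ) : ∃ u1 u2, IsSol (coeff q z) l (specSol q 1 z) u1 u2 ∧
      specSol q 1 z 0 = 0 ∧ u1 0 = 1 ∧ u2 0 = 0 := by
  have := fundSol_one_isSol hl hq (cbrt z)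
  rwa [cbrt_pow_three] at this

/-- By uniqueness the choice of the cube root is irrelevant, so $s_2(\lambda,x)$ depends on
$\lambda^3$ alone. -/
theorem fundSol_two_eq_specSol (hl : 0 ≤ l) (hq : MemLp q 2 (volume.restrict (Set.Ioo 0 l)))
    (lam : ℂ) {x : ℝ} (hx : x ∈ Set.Icc 0 l) : fundSol q 2 lam x = specSol q 2 (lam ^ 3) x := by
  obtain ⟨u1, u2, hu, a0, a1, a2⟩ := fundSol_two_isSol hl hq lam
  obtain ⟨v1, v2, hv, b0, b1, b2⟩ := specSol_two_isSol hl hq (lam ^ 3)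
  exact hu.eq_of_initial hq hv (a0.trans b0.symm) (a1.trans b1.symm) (a2.trans b2.symm) hx

/-- Dominated convergence: monotonicity of `b` supplies one dominating constant on the unit ball
around `w`. -/
theorem continuousAt_integral_mul {u : ℂ → ℝ → ℂ} {k : ℝ → ℂ} {w : ℂ} {b : ℝ → ℝ} {x : ℝ}
    (hx : x ∈ Set.Icc 0 l) (hu : ∀ z, ContinuousOn (u z) (Set.Icc 0 l))
    (hb : ∀ z, ∀ t ∈ Set.Icc 0 l, ‖u z t‖ ≤ b ‖z‖) (hbm : Monotone b)
    (hw : ∀ t ∈ Set.Icc 0 x, ContinuousAt (fun z => u z t) w)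
    (hk : ContinuousOn k (Set.Icc 0 x)) :
    ContinuousAt (fun z => ∫ t in (0 : ℝ)..x, u z t * k t) w := by
  obtain ⟨K, hK⟩ := isCompact_Icc.exists_bound_of_continuousOn hk
  have hb0 : 0 ≤ b (‖w‖ + 1) :=
    (norm_nonneg _).trans ((hb w x hx).trans (hbm (by linarith)))
  refine intervalIntegral.continuousAt_of_dominated_interval
    (bound := fun _ => b (‖w‖ + 1) * K) ?_ ?_ ?_ ?_
  · refine Filter.Eventually.of_forall fun z => ?_
    rw [Set.uIoc_of_le hx.1]
    refine ContinuousOn.aestronglyMeasurable ?_ measurableSet_Ioc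
    refine ContinuousOn.mul ?_ (hk.mono Set.Ioc_subset_Icc_self)
    exact (hu z).mono fun t ht => ⟨ht.1.le, ht.2.trans hx.2⟩
  · filter_upwards [Metric.ball_mem_nhds w one_pos] with z hz
    refine Filter.Eventually.of_forall fun t ht => ?_
    rw [Set.uIoc_of_le hx.1] at ht
    rw [norm_mul]
    refine mul_le_mul ((hb z t ⟨ht.1.le, ht.2.trans hx.2⟩).trans (hbm ?_))
      (hK t ⟨ht.1.le, ht.2⟩) (norm_nonneg _) hb0
    have := norm_sub_norm_le z w
    rw [mem_ball_iff_norm] at hz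
    linarith
  · exact intervalIntegrable_const
  · refine Filter.Eventually.of_forall fun t ht => ?_
    rw [Set.uIoc_of_le hx.1] at ht
    exact (hw t ⟨ht.1.le, ht.2⟩).mul continuousAt_const

/-- A family of solutions with common initial data, locally bounded in the parameter, is
holomorphic in the parameter. -/
theorem differentiable_of_isSol (hl : 0 ≤ l) (hq : MemLp q 2 (volume.restrict (Set.Ioo 0 l)))
    {u u1 u2 : ℂ → ℝ → ℂ} {b0 b1 b2 : ℂ} (hu : ∀ z, IsSol (coeff q z) l (u z) (u1 z) (u2 z))
    (h0 : ∀ z, u z 0 = b0) (h1 : ∀ z, u1 z 0 = b1) (h2 : ∀ z, u2 z 0 = b2)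
    {b : ℝ → ℝ} (hb : ∀ z, ∀ t ∈ Set.Icc 0 l, ‖u z t‖ ≤ b ‖z‖) (hbm : Monotone b)
    {x : ℝ} (hx : x ∈ Set.Icc 0 l) : Differentiable ℂ (fun z => u z x) := by
  -- Two passes through $u_z(x)-u_w(x)=-i(z-w)\int u_zk$: local boundedness first gives continuity
  -- in $z$; the integral is then continuous at $w$, so the difference quotient converges.
  have cont : ∀ {x : ℝ}, x ∈ Set.Icc 0 l → ∀ w, ContinuousAt (fun z => u z x) w := by
    intro x hx w
    obtain ⟨k, a0, a1, a2, hk, hf⟩ := exists_variation_of_constants hq hx w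
    obtain ⟨K, hK⟩ := isCompact_Icc.exists_bound_of_continuousOn hk
    have hdiff : ∀ z, u z x - u w x = -(I * (z - w)) * ∫ t in (0 : ℝ)..x, u z t * k t := by
      intro z
      rw [hf z _ _ _ (hu z), hf w _ _ _ (hu w)]
      simp only [h0, h1, h2, sub_self, mul_zero, zero_mul]
      ring
    have hb0 : 0 ≤ b (‖w‖ + 1) :=
      (norm_nonneg _).trans ((hb w x hx).trans (hbm (by linarith)))
    rw [Metric.continuousAt_iff']
    intro ε hε
    have hball : ∀ᶠ z in nhds w, ‖z - w‖ < 1 ∧ ‖z - w‖ * (b (‖w‖ + 1) * K * x) < ε := by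
      have c1 : ContinuousAt (fun z : ℂ => ‖z - w‖) w := by fun_prop
      have c2 : ContinuousAt (fun z : ℂ => ‖z - w‖ * (b (‖w‖ + 1) * K * x)) w := by fun_prop
      refine (c1.eventually_lt_const (u := 1) (by simp)).and
        (c2.eventually_lt_const (by simpa using hε))
    filter_upwards [hball] with z ⟨hz1, hz2⟩
    rw [dist_eq_norm, hdiff, norm_mul, norm_neg, norm_mul, norm_I, one_mul]
    refine lt_of_le_of_lt (mul_le_mul_of_nonneg_left ?_ (norm_nonneg _)) hz2
    have := intervalIntegral.norm_integral_le_of_norm_le_const (a := 0) (b := x)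
      (f := fun t => u z t * k t) (C := b (‖w‖ + 1) * K) (fun t ht => by
        rw [Set.uIoc_of_le hx.1] at ht
        rw [norm_mul]
        refine mul_le_mul ((hb z t ⟨ht.1.le, ht.2.trans hx.2⟩).trans (hbm ?_))
          (hK t ⟨ht.1.le, ht.2⟩) (norm_nonneg _) hb0
        have := norm_sub_norm_le z w
        linarith)
    rwa [sub_zero, abs_of_nonneg hx.1] at this
  intro w
  obtain ⟨k, a0, a1, a2, hk, hf⟩ := exists_variation_of_constants hq hx w
  have hG : ContinuousAt (fun z => ∫ t in (0 : ℝ)..x, u z t * k t) w :=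
    continuousAt_integral_mul hx (fun z => (hu z).continuousOn hl) hb hbm
      (fun t ht => cont ⟨ht.1, ht.2.trans hx.2⟩ w) hk
  have hform : ∀ z, u z x = (a0 * b0 + a1 * b1 + a2 * b2)
      - I * ((z - w) * ∫ t in (0 : ℝ)..x, u z t * k t) := by
    intro z
    rw [hf z _ _ _ (hu z), h0, h1, h2]
    ring
  have hd : HasDerivAt (fun z => (z - w) * ∫ t in (0 : ℝ)..x, u z t * k t)
      (∫ t in (0 : ℝ)..x, u w t * k t) w := by
    rw [hasDerivAt_iff_tendsto_slope]
    refine (hG.tendsto.mono_left nhdsWithin_le_nhds).congr' ?_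
    filter_upwards [self_mem_nhdsWithin] with z hz
    have : z - w ≠ 0 := sub_ne_zero.2 hz
    simp only [slope, vsub_eq_sub, sub_self, zero_mul, sub_zero, smul_eq_mul]
    field_simp
  have := ((hd.const_mul I).const_sub (a0 * b0 + a1 * b1 + a2 * b2)).differentiableAt
  exact this.congr_of_eventuallyEq (Filter.Eventually.of_forall hform)

theorem exists_specSol_bound (hl : 0 ≤ l) (hq : MemLp q 2 (volume.restrict (Set.Ioo 0 l))) :
    ∃ B : ℝ, 0 < B ∧ ∀ (p : Fin 3) (z : ℂ), ∀ x ∈ Set.Icc 0 l,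
      ‖specSol q p z x‖ ≤ B * Real.exp (‖z‖ ^ (1 / 3 : ℝ) * l) := by
  obtain ⟨B, hB0, hB⟩ := exists_fundSol_bound hl hq
  refine ⟨B, hB0, fun p z x hx => ?_⟩
  have := ((hB p (cbrt z)).2 x hx).2
  rwa [norm_cbrt] at this

/-- The truncation `max r 0` is there because real powers of negative numbers are not monotone; at
norms it changes nothing. -/
theorem monotone_growth {B l : ℝ} (hB : 0 < B) (hl : 0 ≤ l) :
    Monotone fun r : ℝ => B * Real.exp ((max r 0) ^ (1 / 3 : ℝ) * l) := by
  intro r s hrs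
  have := max_le_max_right 0 hrs
  dsimp only
  gcongr

theorem differentiable_specSol_two (hl : 0 ≤ l)
    (hq : MemLp q 2 (volume.restrict (Set.Ioo 0 l))) {x : ℝ} (hx : x ∈ Set.Icc 0 l) :
    Differentiable ℂ (fun z => specSol q 2 z x) := by
  obtain ⟨B, hB0, hB⟩ := exists_specSol_bound hl hq
  choose u1 u2 hu h0 h1 h2 using specSol_two_isSol hl hq
  refine differentiable_of_isSol hl hq hu h0 h1 h2 (fun z t ht => ?_) (monotone_growth hB0 hl) hx
  rw [max_eq_left (norm_nonneg z)]
  exact hB 2 z t ht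

theorem differentiable_specSol_one (hl : 0 ≤ l)
    (hq : MemLp q 2 (volume.restrict (Set.Ioo 0 l))) {x : ℝ} (hx : x ∈ Set.Icc 0 l) :
    Differentiable ℂ (fun z => specSol q 1 z x) := by
  obtain ⟨B, hB0, hB⟩ := exists_specSol_bound hl hq
  choose u1 u2 hu h0 h1 h2 using specSol_one_isSol hl hq
  refine differentiable_of_isSol hl hq hu h0 h1 h2 (fun z t ht => ?_) (monotone_growth hB0 hl) hx
  rw [max_eq_left (norm_nonneg z)]
  exact hB 1 z t ht

end

/-! ### Lagrange's identity and the zeros of the characteristic function -/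

section

variable {q : ℝ → ℝ} {l : ℝ}

theorem conj_coeff (z : ℂ) (x : ℝ) : (starRingEnd ℂ) (coeff q z x) = I * ((starRingEnd ℂ) z - q x) := by
  simp [coeff]

/-- The value `s_2(λ,l)` as a function of `z = λ³`. -/
def specEnd (q : ℝ → ℝ) (l : ℝ) (z : ℂ) : ℂ := specSol q 2 z l

/-- The characteristic function as a function of `z = λ³`. -/
def specFun (q : ℝ → ℝ) (l : ℝ) (θ z : ℂ) : ℂ :=
  -((starRingEnd ℂ) (specEnd q l ((starRingEnd ℂ) z)) + θ * specEnd q l z)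

/-- The Wronskian of `s_1` and `s_2` at `l` is `conj s_2(conj z, l)`. -/
theorem wronskian_end (hl : 0 ≤ l) (hq : MemLp q 2 (volume.restrict (Set.Ioo 0 l))) {z : ℂ}
    {u u1 u2 v v1 v2 : ℝ → ℂ} (hu : IsSol (coeff q z) l u u1 u2)
    (hv : IsSol (coeff q z) l v v1 v2) (hu0 : u 0 = 0) (hu1 : u1 0 = 1)
    (hv0 : v 0 = 0) (hv1 : v1 0 = 0) (hv2 : v2 0 = 1) :
    v l * u1 l - u l * v1 l = -(starRingEnd ℂ) (specEnd q l ((starRingEnd ℂ) z)) := by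
  -- The Wronskian solves the adjoint equation, and conjugation turns that into the original one
  -- with parameter $\bar z$. Its initial data are $0,0,1$, those of $s_2$.
  have hW := ((hu.wronskian hv hl).conj hl).congr_coeff (d := coeff q ((starRingEnd ℂ) z)) hl
    fun x _ => by rw [map_neg, conj_coeff, coeff]; ring
  obtain ⟨s1, s2, hs, h0, h1, h2⟩ := specSol_two_isSol hl hq ((starRingEnd ℂ) z)
  have := hW.eq_of_initial hq hs (by simp [hu0, hv0, h0]) (by simp [hu0, hv0, h1])
    (by simp [hu1, hv2, hv1, h2]) (x := l) ⟨hl, le_rfl⟩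
  rw [specEnd, ← this, conj_conj]
  ring

/-- The two products of values at $l$ form minus the Wronskian of $s_1,s_2$, which `wronskian_end`
identifies with $\overline{S(\bar z)}$. -/
theorem charFun_eq_specFun (hl : 0 < l) (hq : MemLp q 2 (volume.restrict (Set.Ioo 0 l)))
    (θ lam : ℂ) : charFun q l θ lam = specFun q l θ (lam ^ 3) := by
  obtain ⟨u1, u2, hu, hu0, hu1, hu2⟩ := fundSol_one_isSol hl.le hq lam
  obtain ⟨v1, v2, hv, hv0, hv1, hv2⟩ := fundSol_two_isSol hl.le hq lam
  rw [charFun, fundSolDerivEnd_eq hl hu, fundSolDerivEnd_eq hl hv,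
    wronskian_end hl.le hq hu hv hu0 hu1 hv0 hv1 hv2,
    fundSol_two_eq_specSol hl.le hq lam ⟨hl.le, le_rfl⟩, specFun]
  simp only [specEnd]
  ring

theorem differentiable_specEnd (hl : 0 ≤ l) (hq : MemLp q 2 (volume.restrict (Set.Ioo 0 l))) :
    Differentiable ℂ (specEnd q l) :=
  differentiable_specSol_two hl hq ⟨hl, le_rfl⟩

theorem differentiable_specFun (hl : 0 ≤ l) (hq : MemLp q 2 (volume.restrict (Set.Ioo 0 l)))
    (θ : ℂ) : Differentiable ℂ (specFun q l θ) := by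
  have h := differentiable_specEnd hl hq
  have h1 : Differentiable ℂ fun z => (starRingEnd ℂ) (specEnd q l ((starRingEnd ℂ) z)) := by
    intro z
    have := (h ((starRingEnd ℂ) z)).star_star
    rw [show star ((starRingEnd ℂ) z) = z from conj_conj z] at this
    exact this
  exact (h1.add (h.const_mul θ)).neg

theorem integral_mul_conj {u : ℝ → ℂ} (x : ℝ) : ∫ t in (0 : ℝ)..x, u t * (starRingEnd ℂ) (u t)
    = ((∫ t in (0 : ℝ)..x, ‖u t‖ ^ 2 : ℝ) : ℂ) := by
  rw [← intervalIntegral.integral_ofReal]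
  refine intervalIntegral.integral_congr fun t _ => ?_
  exact (mul_conj _).trans (by rw [normSq_eq_norm_sq])

/-- Lagrange's identity for two solutions and spectral parameters `z`, `conj w`. -/
theorem lagrange_conj (hl : 0 ≤ l) {z w : ℂ} {u u1 u2 v v1 v2 : ℝ → ℂ}
    (hu : IsSol (coeff q z) l u u1 u2) (hv : IsSol (coeff q w) l v v1 v2) {x : ℝ}
    (hx : x ∈ Set.Icc 0 l) :
    u2 x * (starRingEnd ℂ) (v x) - u1 x * (starRingEnd ℂ) (v1 x) + u x * (starRingEnd ℂ) (v2 x)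
      = u2 0 * (starRingEnd ℂ) (v 0) - u1 0 * (starRingEnd ℂ) (v1 0)
        + u 0 * (starRingEnd ℂ) (v2 0)
        - I * (z - (starRingEnd ℂ) w) * ∫ t in (0 : ℝ)..x, u t * (starRingEnd ℂ) (v t) := by
  rw [hu.lagrange (hv.conj hl) hl hx, sub_eq_add_neg _ (I * _ * _), ← neg_mul,
    ← intervalIntegral.integral_const_mul]
  congr 1
  refine intervalIntegral.integral_congr fun t _ => ?_
  simp only [conj_coeff]
  rw [coeff]
  ring

/-- `s_2(z,l)` has no real zeros. -/
theorem specEnd_ofReal_ne_zero (hl : 0 < l) (hq : MemLp q 2 (volume.restrict (Set.Ioo 0 l)))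
    (r : ℝ) : specEnd q l r ≠ 0 := by
  obtain ⟨u1, u2, hu, h0, h1, h2⟩ := specSol_two_isSol hl.le hq (r : ℂ)
  unfold specEnd
  set u := specSol q 2 (r : ℂ)
  intro hul
  have hc := hu.conj hl.le
  have hp := hu.prim.mul hc.prim hl.le
  -- For real $z$ Lagrange's identity reads $u''\bar u+u\bar u''=|u'|^2$, so $(|u|^2)''=3|u'|^2$.
  -- Thus $|u|^2$ increases from $0$ with zero initial slope, and a zero at $l$ would force
  -- $u\equiv0$ against $u''(0)=1$.
  have hp1 := ((hu.prim1.mul hc.prim hl.le).add (hu.prim.mul hc.prim1 hl.le)).congr_deriv hl.le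
    (g' := fun x => 3 * (u1 x * (starRingEnd ℂ) (u1 x))) fun x hx => by
      have := lagrange_conj hl.le hu hu hx
      simp only [conj_ofReal, sub_self, mul_zero, zero_mul, h0, h1, map_zero] at this
      linear_combination this
  have hn1 : ∀ x ∈ Set.Icc 0 l, u1 x * (starRingEnd ℂ) (u x) + u x * (starRingEnd ℂ) (u1 x)
      = ((3 * ∫ t in (0 : ℝ)..x, ‖u1 t‖ ^ 2 : ℝ) : ℂ) := by
    intro x hx
    have := hp1.eq_add_integral x hx
    rw [intervalIntegral.integral_const_mul, integral_mul_conj] at this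
    rw [this]
    simp [h0]
  have hn : ∀ x ∈ Set.Icc 0 l, ‖u x‖ ^ 2 = ∫ s in (0 : ℝ)..x, 3 * ∫ t in (0 : ℝ)..s, ‖u1 t‖ ^ 2 := by
    intro x hx
    have := (hp.congr_deriv hl.le hn1).eq_add_integral x hx
    rw [intervalIntegral.integral_ofReal, mul_conj, normSq_eq_norm_sq] at this
    simp only [h0, zero_mul, zero_add] at this
    exact_mod_cast this
  have hint : IntervalIntegrable (fun s => 3 * ∫ t in (0 : ℝ)..s, ‖u1 t‖ ^ 2) volume 0 l := by
    have h := (hp.congr_deriv hl.le hn1).integrable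
    have h' := (h.norm).congr (g := fun s => 3 * ∫ t in (0 : ℝ)..s, ‖u1 t‖ ^ 2) (fun s hs => by
      rw [Set.uIoc_of_le hl.le] at hs
      simp only [norm_real, Real.norm_eq_abs]
      refine abs_of_nonneg (mul_nonneg (by norm_num) ?_)
      exact intervalIntegral.integral_nonneg hs.1.le fun t _ => by positivity)
    exact h'
  have hz : ∀ x ∈ Set.Icc 0 l, u x = 0 := by
    intro x hx
    have hle : ∫ s in (0 : ℝ)..x, 3 * ∫ t in (0 : ℝ)..s, ‖u1 t‖ ^ 2
        ≤ ∫ s in (0 : ℝ)..l, 3 * ∫ t in (0 : ℝ)..s, ‖u1 t‖ ^ 2 := by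
      refine intervalIntegral.integral_mono_interval le_rfl hx.1 hx.2 ?_ hint
      filter_upwards [ae_restrict_mem measurableSet_Ioc] with s hs
      refine mul_nonneg (by norm_num) ?_
      exact intervalIntegral.integral_nonneg hs.1.le fun t _ => by positivity
    rw [← hn x hx, ← hn l ⟨hl.le, le_rfl⟩, hul] at hle
    have : ‖u x‖ ^ 2 = 0 := le_antisymm (by simpa using hle) (by positivity)
    simpa using this
  have := (hu.derivs_eq_zero hl hz 0 ⟨le_rfl, hl.le⟩).2
  rw [h2] at this
  exact one_ne_zero this

/-- `s_2(z,l)` has no zeros in the open upper half-plane. -/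
theorem specEnd_ne_zero_of_im_pos (hl : 0 < l) (hq : MemLp q 2 (volume.restrict (Set.Ioo 0 l)))
    {z : ℂ} (hz : 0 < z.im) : specEnd q l z ≠ 0 := by
  obtain ⟨u1, u2, hu, h0, h1, h2⟩ := specSol_two_isSol hl.le hq z
  unfold specEnd
  set u := specSol q 2 z
  intro hul
  have h := lagrange_conj hl.le hu hu (x := l) ⟨hl.le, le_rfl⟩
  rw [integral_mul_conj] at h
  simp only [h0, h1, hul, map_zero, mul_zero, zero_mul, add_zero, zero_sub, sub_self,
    sub_conj, mul_conj, normSq_eq_norm_sq] at h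
  -- The two sides have opposite signs when $\operatorname{Im} z>0$, hence both vanish.
  have h' : -‖u1 l‖ ^ 2 = 2 * z.im * ∫ t in (0 : ℝ)..l, ‖u t‖ ^ 2 := by
    have : ((-‖u1 l‖ ^ 2 : ℝ) : ℂ) = ((2 * z.im * ∫ t in (0 : ℝ)..l, ‖u t‖ ^ 2 : ℝ) : ℂ) := by
      push_cast at h ⊢
      linear_combination h - (2 * z.im * ((∫ t in (0 : ℝ)..l, ‖u t‖ ^ 2 : ℝ) : ℂ)) * I_sq
    exact_mod_cast this
  have hnn : 0 ≤ ∫ t in (0 : ℝ)..l, ‖u t‖ ^ 2 :=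
    intervalIntegral.integral_nonneg hl.le fun t _ => by positivity
  have hJ : ∫ t in (0 : ℝ)..l, ‖u t‖ ^ 2 = 0 := by
    by_contra hne
    have : 0 < ∫ t in (0 : ℝ)..l, ‖u t‖ ^ 2 := lt_of_le_of_ne hnn (Ne.symm hne)
    have : 0 < 2 * z.im * ∫ t in (0 : ℝ)..l, ‖u t‖ ^ 2 := by positivity
    nlinarith [sq_nonneg ‖u1 l‖]
  have hz := eq_zero_of_integral_mul_conj_eq_zero hl (hu.continuousOn hl.le)
    (by rw [integral_mul_conj, hJ, ofReal_zero])
  have := (hu.derivs_eq_zero hl hz 0 ⟨le_rfl, hl.le⟩).2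
  rw [h2] at this
  exact one_ne_zero this

/-- All zeros of the characteristic function are real. -/
theorem im_eq_zero_of_specFun_eq_zero (hl : 0 < l)
    (hq : MemLp q 2 (volume.restrict (Set.Ioo 0 l))) {θ z : ℂ} (hθ : ‖θ‖ = 1)
    (hz : specFun q l θ z = 0) : z.im = 0 := by
  by_contra him
  obtain ⟨u1, u2, hu, hu0, hu1, hu2⟩ := specSol_one_isSol hl.le hq z
  obtain ⟨v1, v2, hv, hv0, hv1, hv2⟩ := specSol_two_isSol hl.le hq z
  have hW := wronskian_end hl.le hq hu hv hu0 hu1 hv0 hv1 hv2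
  set u := specSol q 1 z
  set v := specSol q 2 z with hvdef
  have hvl : specEnd q l z = v l := rfl
  set S := specEnd q l z
  set D := (starRingEnd ℂ) (specEnd q l ((starRingEnd ℂ) z)) with hD
  have hDS : D = -(θ * S) := by
    rw [specFun, neg_eq_zero] at hz
    linear_combination hz
  -- This $y=S\,s_1-s_1(l)s_2$ satisfies $y(0)=y(l)=0$, $y'(0)=S$ and, at a zero of $F$,
  -- $y'(l)=\theta S$. As $|\theta|=1$, the boundary terms in Lagrange's identity cancel.
  have hy := (hu.const_mul hl.le S).add (hv.const_mul hl.le (-u l)) hl.le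
  have h := lagrange_conj hl.le hy hy (x := l) ⟨hl.le, le_rfl⟩
  have e1 : S * u l + -u l * v l = 0 := by rw [hvl]; ring
  have e2 : S * u1 l + -u l * v1 l = θ * S := by
    rw [hvl]; linear_combination hW - hDS + θ * hvl
  have hn : θ * (starRingEnd ℂ) θ = 1 := by
    rw [mul_conj, normSq_eq_norm_sq, hθ]; simp
  simp only [e1, e2, hu0, hv0, hu1, hv1, map_zero, mul_zero, zero_mul, add_zero, zero_sub,
    mul_one, map_mul, sub_conj] at h
  have hint : ∫ t in (0 : ℝ)..l, (S * u t + -u l * v t)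
      * (starRingEnd ℂ) (S * u t + -u l * v t) = 0 := by
    have h3 : I * (((2 * z.im : ℝ) : ℂ) * I) * (∫ t in (0 : ℝ)..l, (S * u t + -u l * v t)
      * (starRingEnd ℂ) (S * u t + -u l * v t)) = 0 := by
      linear_combination h + S * (starRingEnd ℂ) S * hn
    refine (mul_eq_zero.1 h3).resolve_left ?_
    refine mul_ne_zero I_ne_zero (mul_ne_zero ?_ I_ne_zero)
    exact_mod_cast mul_ne_zero two_ne_zero him
  have hy0 := eq_zero_of_integral_mul_conj_eq_zero hl (hy.continuousOn hl.le) hint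
  have hd := (hy.derivs_eq_zero hl hy0 0 ⟨le_rfl, hl.le⟩).1
  rw [hu1, hv1, mul_one, mul_zero, add_zero] at hd
  -- Now $y\equiv0$ gives $S(z)=0$, and $F(z)=0$ gives $S(\bar z)=0$; one of $z,\bar z$ lies in the
  -- upper half-plane.
  have hD0 : specEnd q l ((starRingEnd ℂ) z) = 0 := by
    rw [hd, mul_zero, neg_zero] at hDS
    simpa [hD] using hDS
  rcases lt_or_gt_of_ne him with h1 | h1
  · exact specEnd_ne_zero_of_im_pos hl hq (z := (starRingEnd ℂ) z) (by simpa using h1) hD0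
  · exact specEnd_ne_zero_of_im_pos hl hq h1 hd

/-- All zeros of the characteristic function are simple in the variable `z = λ³`. -/
theorem deriv_specFun_ne_zero (hl : 0 < l)
    (hq : MemLp q 2 (volume.restrict (Set.Ioo 0 l))) {θ w : ℂ} (hθ : ‖θ‖ = 1)
    (hw : specFun q l θ w = 0) : deriv (specFun q l θ) w ≠ 0 := by
  intro hder
  obtain ⟨r, rfl⟩ : ∃ r : ℝ, (r : ℂ) = w :=
    ⟨w.re, Complex.ext (by simp) (by simp [im_eq_zero_of_specFun_eq_zero hl hq hθ hw])⟩
  choose u1 u2 hu hu0 hu1 hu2 using specSol_one_isSol hl.le hq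
  choose v1 v2 hv hv0 hv1 hv2 using specSol_two_isSol hl.le hq
  have hll : l ∈ Set.Icc 0 l := ⟨hl.le, le_rfl⟩
  set u := specSol q 1 with hudef
  set v := specSol q 2 with hvdef
  have hS0 : v r l ≠ 0 := specEnd_ofReal_ne_zero hl hq r
  have hy := fun z => ((hu z).const_mul hl.le (v z l)).add ((hv z).const_mul hl.le (-u z l)) hl.le
  have hD : ∀ z, v z l * u1 z l + -u z l * v1 z l = specFun q l θ z + θ * v z l := by
    intro z
    have := wronskian_end hl.le hq (hu z) (hv z) (hu0 z) (hu1 z) (hv0 z) (hv1 z) (hv2 z)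
    rw [specFun]
    have e : specEnd q l z = v z l := rfl
    rw [e]
    linear_combination this
  set k : ℝ → ℂ := fun t => (starRingEnd ℂ) (v r l * u r t + -u r l * v r t) with hk
  have hkc : ContinuousOn k (Set.Icc 0 l) := ((hy r).conj hl.le).continuousOn hl.le
  set G : ℂ → ℂ := fun z => ∫ t in (0 : ℝ)..l, (v z l * u z t + -u z l * v z t) * k t with hG
  have hn : θ * (starRingEnd ℂ) θ = 1 := by
    rw [mul_conj, normSq_eq_norm_sq, hθ]; simp
  -- Pairing $y_z$ with $y_r$ exhibits the factor $z-r$ in $F$, with cofactor $G$ and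
  -- $G(r)=\int|y_r|^2$. A double zero would give $y_r\equiv0$, contradicting $y_r'(0)=S(r)\ne0$.
  have hid : ∀ z, specFun q l θ z * ((starRingEnd ℂ) θ * (starRingEnd ℂ) (v r l))
      = I * ((z - r) * G z) := by
    intro z
    have h := lagrange_conj hl.le (hy z) (hy r) (x := l) hll
    have e1 : ∀ z, v z l * u z l + -u z l * v z l = 0 := fun z => by ring
    have e0 : specFun q l θ r = 0 := hw
    rw [conj_ofReal] at h
    simp only [e1, hD, e0, hu0, hv0, hu1, hv1, map_zero, mul_zero, zero_mul, add_zero, zero_sub,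
      mul_one, map_mul, zero_add] at h
    change _ = _ - I * (z - r) * G z at h
    linear_combination -h - v z l * (starRingEnd ℂ) (v r l) * hn
  have hGc : ContinuousAt G r := by
    obtain ⟨B, hB0, hB⟩ := exists_specSol_bound hl.le hq
    have hbd : ∀ p z, ∀ t ∈ Set.Icc 0 l, ‖specSol q p z t‖
        ≤ (fun r : ℝ => B * Real.exp ((max r 0) ^ (1 / 3 : ℝ) * l)) ‖z‖ := by
      intro p z t ht
      simp only [max_eq_left (norm_nonneg z)]
      exact hB p z t ht
    have c1 : ContinuousAt (fun z => ∫ t in (0 : ℝ)..l, u z t * k t) r :=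
      continuousAt_integral_mul hll (fun z => (hu z).continuousOn hl.le) (hbd 1)
        (monotone_growth hB0 hl.le)
        (fun t ht => (differentiable_specSol_one hl.le hq ht).continuous.continuousAt) hkc
    have c2 : ContinuousAt (fun z => ∫ t in (0 : ℝ)..l, v z t * k t) r :=
      continuousAt_integral_mul hll (fun z => (hv z).continuousOn hl.le) (hbd 2)
        (monotone_growth hB0 hl.le)
        (fun t ht => (differentiable_specSol_two hl.le hq ht).continuous.continuousAt) hkc
    have d1 : ContinuousAt (fun z => v z l) r :=
      (differentiable_specSol_two hl.le hq hll).continuous.continuousAt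
    have d2 : ContinuousAt (fun z => u z l) r :=
      (differentiable_specSol_one hl.le hq hll).continuous.continuousAt
    have : G = fun z => v z l * (∫ t in (0 : ℝ)..l, u z t * k t)
        + -u z l * ∫ t in (0 : ℝ)..l, v z t * k t := by
      ext z
      have huk : IntervalIntegrable (fun t => u z t * k t) volume 0 l := by
        refine ContinuousOn.intervalIntegrable ?_
        rw [Set.uIcc_of_le hl.le]
        exact ((hu z).continuousOn hl.le).mul hkc
      have hvk : IntervalIntegrable (fun t => v z t * k t) volume 0 l := by
        refine ContinuousOn.intervalIntegrable ?_
        rw [Set.uIcc_of_le hl.le]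
        exact ((hv z).continuousOn hl.le).mul hkc
      rw [← intervalIntegral.integral_const_mul, ← intervalIntegral.integral_const_mul,
        ← intervalIntegral.integral_add (huk.const_mul _) (hvk.const_mul _)]
      refine intervalIntegral.integral_congr fun t _ => ?_
      ring
    rw [this]
    exact (d1.mul c1).add (d2.neg.mul c2)
  have hd : HasDerivAt (fun z => (z - (r : ℂ)) * G z) (G r) r := by
    rw [hasDerivAt_iff_tendsto_slope]
    refine (hGc.tendsto.mono_left nhdsWithin_le_nhds).congr' ?_
    filter_upwards [self_mem_nhdsWithin] with z hz
    have : z - r ≠ 0 := sub_ne_zero.2 hz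
    simp only [slope, vsub_eq_sub, sub_self, zero_mul, sub_zero, smul_eq_mul]
    field_simp
  have hd1 := (differentiable_specFun hl.le hq θ r).hasDerivAt.mul_const
    ((starRingEnd ℂ) θ * (starRingEnd ℂ) (v r l))
  have hd2 := hd.const_mul I
  have heq := hd1.unique (hd2.congr_of_eventuallyEq (Filter.Eventually.of_forall hid))
  rw [hder, zero_mul] at heq
  have hG0 : G r = 0 := (mul_eq_zero.1 heq.symm).resolve_left I_ne_zero
  have hy0 := eq_zero_of_integral_mul_conj_eq_zero hl ((hy r).continuousOn hl.le) hG0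
  have := ((hy r).derivs_eq_zero hl hy0 0 ⟨le_rfl, hl.le⟩).1
  rw [hu1, hv1, mul_one, mul_zero, add_zero] at this
  exact hS0 this

theorem exists_specFun_bound (hl : 0 ≤ l) (hq : MemLp q 2 (volume.restrict (Set.Ioo 0 l))) :
    ∃ B : ℝ, 0 < B ∧ ∀ θ z : ℂ, ‖θ‖ = 1 →
      ‖specFun q l θ z‖ ≤ B * Real.exp (‖z‖ ^ (1 / 3 : ℝ) * l) := by
  obtain ⟨B, hB0, hB⟩ := exists_specSol_bound hl hq
  refine ⟨2 * B, by positivity, fun θ z hθ => ?_⟩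
  have h1 := hB 2 z l ⟨hl, le_rfl⟩
  have h2 := hB 2 ((starRingEnd ℂ) z) l ⟨hl, le_rfl⟩
  rw [RCLike.norm_conj] at h2
  rw [specFun, norm_neg]
  refine (norm_add_le _ _).trans ?_
  rw [RCLike.norm_conj, norm_mul, hθ, one_mul, specEnd, specEnd]
  linarith

end

/-! ### Growth along the real and imaginary axes -/

section

variable {q : ℝ → ℝ} {l : ℝ}

/-- Growth of `s_2(λ,l)` in terms of the largest exponent. -/
theorem exists_specEnd_bound (hl : 0 ≤ l) (hq : MemLp q 2 (volume.restrict (Set.Ioo 0 l))) :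
    ∃ B : ℝ, 0 < B ∧ ∀ (lam : ℂ) (τ : ℝ), 1 ≤ ‖lam‖ → 0 ≤ τ →
      (∀ k, (I * lam * zeta k).re ≤ τ) → ‖specEnd q l (lam ^ 3)‖ ≤ B * Real.exp (τ * l) := by
  obtain ⟨Q, hQ0, hQ⟩ := exists_integral_abs_mul_exp_le hl hq
  -- For $|\lambda|\ge1$ the free solution is bounded with constant $1$, and this weight makes the
  -- contraction constant $1/2$.
  set M : ℝ := (2 * Q) ^ 2 with hM
  have hM0 : 0 < M := by positivity
  have hsq : √M = 2 * Q := Real.sqrt_sq (by positivity)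
  have hr : 1 * (Q / √M) = 1 / 2 := by rw [hsq]; field_simp
  refine ⟨2 * Real.exp (M * l), by positivity, fun lam τ hlam hτ hk => ?_⟩
  have hne : lam ≠ 0 := norm_pos_iff.1 (by linarith)
  have hfree : ∀ x ∈ Set.Icc 0 l, ‖freeSol 2 lam x‖ ≤ 1 * Real.exp (τ * x) := by
    intro x hx
    refine (norm_freeSol_le 2 hne hx.1 hk).trans ?_
    refine mul_le_mul_of_nonneg_right ?_ (Real.exp_pos _).le
    exact inv_le_one_of_one_le₀ (one_le_pow₀ hlam)
  have key := ((fundSol_volterra (lam := lam) 2 hl (intervalIntegrable_of_memLp hl hq).1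
    (hQ M hM0) (by positivity) hM0.le zero_le_one zero_le_one hτ hfree hfree
    (by rw [hr]; norm_num)).2 l ⟨hl, le_rfl⟩).2
  rw [fundSol_two_eq_specSol hl hq lam ⟨hl, le_rfl⟩, hr] at key
  refine key.trans (le_of_eq ?_)
  rw [add_mul, Real.exp_add, show (1 - 1 / 2 : ℝ)⁻¹ = 2 by norm_num]
  ring

theorem zeta_re_le (k : Fin 3) : -(1 / 2) ≤ (zeta k).re ∧ (zeta k).re ≤ 1 := by
  fin_cases k <;> simp [zeta] <;> norm_num

theorem abs_zeta_im_le (k : Fin 3) : |(zeta k).im| ≤ √3 / 2 := by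
  have h : 0 ≤ √3 / 2 := by positivity
  fin_cases k
  · simpa [zeta] using h
  · simp [zeta, abs_div, abs_of_nonneg (Real.sqrt_nonneg 3)]
  · simp [zeta, abs_div, abs_of_nonneg (Real.sqrt_nonneg 3)]

/-- For real $\lambda$ the exponents have real part $-\lambda\operatorname{Im}\zeta$, at most
$\tfrac{\sqrt3}{2}|\lambda|$: a rate strictly below the $\kappa$ reached on the imaginary axis. -/
theorem norm_specEnd_real_le {B : ℝ} (hB : ∀ (lam : ℂ) (τ : ℝ), 1 ≤ ‖lam‖ → 0 ≤ τ →
      (∀ k, (I * lam * zeta k).re ≤ τ) → ‖specEnd q l (lam ^ 3)‖ ≤ B * Real.exp (τ * l))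
    {r : ℝ} (hr : 1 ≤ |r|) :
    ‖specEnd q l ((r : ℂ) ^ 3)‖ ≤ B * Real.exp (√3 / 2 * |r| * l) := by
  refine hB r _ (by simpa using hr) (by positivity) fun k => ?_
  have h : (I * (r : ℂ) * zeta k).re = -(r * (zeta k).im) := by
    simp [mul_re, mul_im]
  rw [h]
  refine (neg_le_abs _).trans ?_
  rw [abs_mul, mul_comm]
  exact mul_le_mul_of_nonneg_right (abs_zeta_im_le k) (abs_nonneg _)

/-- `s_2(z,l)` is exponentially large on the positive imaginary axis. -/
theorem eventually_le_norm_specEnd_imag (hl : 0 < l)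
    (hq : MemLp q 2 (volume.restrict (Set.Ioo 0 l))) :
    ∀ᶠ κ : ℝ in Filter.atTop,
      Real.exp (κ * l) / (6 * κ ^ 2) ≤ ‖specEnd q l (I * (κ : ℂ) ^ 3)‖ := by
  obtain ⟨Q, hQ0, hQ⟩ := exists_integral_abs_mul_exp_le hl.le hq
  have hQ1 := hQ 1 one_pos
  rw [Real.sqrt_one, div_one] at hQ1
  -- The $2Q$ gives contraction constant at most $1/2$, the $24Qe^l$ makes the perturbation at most
  -- $e^{\kappa l}/(12\kappa^2)$, and $e^{\kappa l}\ge8$ below yields $(E-2)/3-E/12\ge E/6$ for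
  -- $E=e^{\kappa l}$. Weight $M=1$ suffices because smallness comes from $\kappa^{-2}$.
  have e1 : ∀ᶠ κ : ℝ in Filter.atTop, 2 * Q + 24 * Q * Real.exp l ≤ κ ^ 2 :=
    (Filter.tendsto_pow_atTop two_ne_zero).eventually_ge_atTop _
  have e2 : ∀ᶠ κ : ℝ in Filter.atTop, 8 ≤ Real.exp (κ * l) :=
    (Real.tendsto_exp_atTop.comp (Filter.tendsto_id.atTop_mul_const hl)).eventually_ge_atTop 8
  filter_upwards [e1, e2, Filter.eventually_ge_atTop 1] with κ h1 h2 hκ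
  have hκ0 : 0 < κ := by linarith
  -- Then $i\lambda=\kappa$: the root $\zeta=1$ gives $e^{\kappa l}$, while the other two
  -- exponentials decay.
  set lam : ℂ := -I * κ with hlam
  have hIlam : I * lam = κ := by rw [hlam]; linear_combination -(κ : ℂ) * I_sq
  have hlam3 : lam ^ 3 = I * (κ : ℂ) ^ 3 := by
    rw [hlam]; linear_combination -(I * (κ : ℂ) ^ 3) * I_sq
  have hne : lam ≠ 0 := by
    rw [hlam]
    exact mul_ne_zero (neg_ne_zero.2 I_ne_zero) (by exact_mod_cast hκ0.ne')
  have hnorm : ‖lam‖ = κ := by rw [hlam]; simp [abs_of_pos hκ0]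
  have hfree : ∀ x ∈ Set.Icc 0 l, ‖freeSol 2 lam x‖ ≤ (κ ^ 2)⁻¹ * Real.exp (κ * x) := by
    intro x hx
    have := norm_freeSol_le 2 hne hx.1 (τ := κ) (fun k => by
      rw [hIlam, re_ofReal_mul]
      have := (zeta_re_le k).2
      nlinarith)
    rwa [hnorm] at this
  have hll : l ∈ Set.Icc 0 l := ⟨hl.le, le_rfl⟩
  have hCQ : (κ ^ 2)⁻¹ * Q ≤ 1 / 2 := by
    rw [inv_mul_le_iff₀ (by positivity)]
    have : 0 < 24 * Q * Real.exp l := by positivity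
    linarith
  have hq1 := (intervalIntegrable_of_memLp hl.le hq).1
  have key := (fundSol_volterra (lam := lam) 2 hl.le hq1
    hQ1 hQ0.le zero_le_one (by positivity) (by positivity) hκ0.le hfree hfree
    (by linarith)).2
  have hA : (1 - (κ ^ 2)⁻¹ * Q)⁻¹ ≤ 2 := by
    rw [inv_le_comm₀ (by linarith) (by norm_num)]
    linarith
  have hvol := norm_volterra_le (A := (κ ^ 2)⁻¹ * (1 - (κ ^ 2)⁻¹ * Q)⁻¹) hq1 hQ1
    (mul_nonneg (by positivity) (inv_nonneg.2 (by linarith))) (by positivity) hfree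
    (fun x hx => (key x hx).2) hll
  have hlow : (κ ^ 2)⁻¹ * ((Real.exp (κ * l) - 2) / 3) ≤ ‖freeSol 2 lam l‖ := by
    simp only [freeSol, hne, if_false, hIlam, norm_div, norm_pow, norm_real, Real.norm_eq_abs,
      abs_of_pos hκ0, Fin.val_two]
    rw [div_eq_inv_mul (‖_‖)]
    refine mul_le_mul_of_nonneg_left ?_ (by positivity)
    have hz : ∀ k : Fin 3, k ≠ 0 → ‖1 / zeta k ^ 2 * exp (κ * l * zeta k)‖ ≤ 1 := by
      intro k hk
      rw [norm_mul, norm_div, norm_pow, norm_zeta, norm_exp]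
      simp only [norm_one, one_pow, div_one, one_mul]
      rw [Real.exp_le_one_iff, ← ofReal_mul, re_ofReal_mul]
      refine mul_nonpos_of_nonneg_of_nonpos (by positivity) ?_
      fin_cases k
      · exact absurd rfl hk
      · simp [zeta]; norm_num
      · simp [zeta]; norm_num
    have hsum : sFun 2 (κ * l) = 1 / 3 * (exp (κ * l) + (1 / zeta 1 ^ 2 * exp (κ * l * zeta 1)
        + 1 / zeta 2 ^ 2 * exp (κ * l * zeta 2))) := by
      rw [sFun, Fin.sum_univ_three]
      simp only [Fin.val_two]
      have : zeta 0 = 1 := rfl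
      rw [this, mul_one, one_pow, div_one, one_mul]
      ring
    rw [hsum, norm_mul]
    have hn3 : ‖(1 / 3 : ℂ)‖ = 1 / 3 := by norm_num
    rw [hn3]
    have hn1 : ‖exp ((κ : ℂ) * l)‖ = Real.exp (κ * l) := by
      rw [norm_exp, ← ofReal_mul, ofReal_re]
    have hn2 := norm_sub_le_norm_add (exp ((κ : ℂ) * l)) (1 / zeta 1 ^ 2 * exp (κ * l * zeta 1)
        + 1 / zeta 2 ^ 2 * exp (κ * l * zeta 2))
    have hn4 := norm_add_le (1 / zeta 1 ^ 2 * exp (κ * l * zeta 1))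
      (1 / zeta 2 ^ 2 * exp (κ * l * zeta 2))
    have z1 := hz 1 (by decide)
    have z2 := hz 2 (by decide)
    rw [hn1] at hn2
    linarith
  have heq := (key l hll).1
  rw [fundSol_two_eq_specSol hl.le hq lam hll, hlam3] at heq
  have hmain : ‖freeSol 2 lam l‖ - ‖volterra q lam (fundSol q 2 lam) l‖
      ≤ ‖specEnd q l (I * (κ : ℂ) ^ 3)‖ := by
    rw [specEnd, heq]
    refine le_trans (le_of_eq ?_) (norm_sub_le_norm_add _ _)
    rw [norm_mul, norm_I, one_mul]
  refine le_trans ?_ hmain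
  have hvol' : ‖volterra q lam (fundSol q 2 lam) l‖
      ≤ (κ ^ 2)⁻¹ * (Real.exp (κ * l) / 12) := by
    refine hvol.trans ?_
    have e : Real.exp ((κ + 1) * l) = Real.exp (κ * l) * Real.exp l := by
      rw [← Real.exp_add]; ring_nf
    rw [e]
    calc _ ≤ (κ ^ 2)⁻¹ * 2 * ((κ ^ 2)⁻¹ * Q) * (Real.exp (κ * l) * Real.exp l) := by gcongr
      _ = (κ ^ 2)⁻¹ * (Real.exp (κ * l) * ((κ ^ 2)⁻¹ * (2 * Q * Real.exp l))) := by ring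
      _ ≤ (κ ^ 2)⁻¹ * (Real.exp (κ * l) * (1 / 12)) := by
        gcongr
        rw [inv_mul_le_iff₀ (by positivity)]
        linarith
      _ = _ := by ring
  have e : Real.exp (κ * l) / (6 * κ ^ 2) = (κ ^ 2)⁻¹ * (Real.exp (κ * l) / 6) := by
    field_simp
  rw [e]
  have : (κ ^ 2)⁻¹ * (Real.exp (κ * l) / 6)
      ≤ (κ ^ 2)⁻¹ * ((Real.exp (κ * l) - 2) / 3 - Real.exp (κ * l) / 12) := by
    refine mul_le_mul_of_nonneg_left ?_ (by positivity)
    linarith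
  rw [mul_sub] at this
  linarith

/-- The characteristic function grows faster on the positive imaginary axis than on the real
axis. -/
theorem eventually_specFun_real_lt_imag (hl : 0 < l)
    (hq : MemLp q 2 (volume.restrict (Set.Ioo 0 l))) {θ : ℂ} (hθ : ‖θ‖ = 1) {K : ℝ}
    (hK : 0 ≤ K) :
    ∀ᶠ κ : ℝ in Filter.atTop, ∀ r : ℝ, |r| = κ →
      K * ‖specFun q l θ ((r : ℂ) ^ 3)‖ < ‖specFun q l θ (I * (κ : ℂ) ^ 3)‖ := by
  obtain ⟨B, hB0, hB⟩ := exists_specEnd_bound hl.le hq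
  have hs3 : √3 ^ 2 = 3 := Real.sq_sqrt (by norm_num)
  have hs : 0 ≤ √3 := Real.sqrt_nonneg 3
  have hβ : √3 / 2 < 1 := by nlinarith
  have hβ' : 1 / 2 ≤ √3 / 2 := by nlinarith
  have hpos : 0 < (1 - √3 / 2) * l := mul_pos (by linarith) hl
  -- The part $2KB$ pays for the two terms on the real axis, $B$ for the conjugate term on the
  -- imaginary axis, $6\kappa^2$ for the lower bound of $S$; the final $+1$ makes the inequality
  -- strict.
  have e1 : ∀ᶠ κ : ℝ in Filter.atTop,
      (6 * (2 * K + 1) * B + 1) * κ ^ 2 ≤ Real.exp ((1 - √3 / 2) * l * κ) := by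
    have h := (isLittleO_pow_exp_pos_mul_atTop 2 hpos).def
      (c := (6 * (2 * K + 1) * B + 1)⁻¹) (by positivity)
    filter_upwards [h] with κ hκ
    rw [Real.norm_eq_abs, Real.norm_eq_abs, abs_of_nonneg (by positivity), Real.abs_exp,
      ← div_eq_inv_mul, le_div_iff₀ (by positivity)] at hκ
    linarith
  filter_upwards [e1, eventually_le_norm_specEnd_imag hl hq, Filter.eventually_ge_atTop 1]
    with κ h1 h2 hκ r hr
  have hκ0 : 0 < κ := by linarith
  have hreal : ‖specFun q l θ ((r : ℂ) ^ 3)‖ ≤ 2 * (B * Real.exp (√3 / 2 * κ * l)) := by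
    have hb := norm_specEnd_real_le hB (r := r) (by rw [hr]; exact hκ)
    rw [hr] at hb
    rw [specFun, norm_neg]
    refine (norm_add_le _ _).trans ?_
    rw [RCLike.norm_conj, norm_mul, hθ, one_mul, map_pow, conj_ofReal]
    linarith
  -- Only one term of $F$ is large: here $\bar z=(i\kappa)^3$ has exponents $-\kappa\zeta$, with
  -- real parts at most $\kappa/2$.
  have hconj : ‖specEnd q l ((starRingEnd ℂ) (I * (κ : ℂ) ^ 3))‖
      ≤ B * Real.exp (√3 / 2 * κ * l) := by
    have e : (starRingEnd ℂ) (I * (κ : ℂ) ^ 3) = (I * (κ : ℂ)) ^ 3 := by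
      rw [map_mul, map_pow, conj_I, conj_ofReal]
      linear_combination -(I * (κ : ℂ) ^ 3) * I_sq
    rw [e]
    refine hB (I * κ) _ (by simpa [abs_of_pos hκ0] using hκ) (by positivity) fun k => ?_
    have e' : I * (I * (κ : ℂ)) * zeta k = ((-κ : ℝ) : ℂ) * zeta k := by
      push_cast; linear_combination (κ : ℂ) * zeta k * I_sq
    rw [e', re_ofReal_mul]
    have := (zeta_re_le k).1
    nlinarith
  have himag : ‖specEnd q l (I * (κ : ℂ) ^ 3)‖ - B * Real.exp (√3 / 2 * κ * l)
      ≤ ‖specFun q l θ (I * (κ : ℂ) ^ 3)‖ := by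
    rw [specFun, norm_neg, add_comm]
    refine le_trans ?_ (norm_sub_le_norm_add _ _)
    rw [RCLike.norm_conj, norm_mul, hθ, one_mul]
    linarith
  refine lt_of_lt_of_le ?_ himag
  have hexp : Real.exp (κ * l) = Real.exp ((1 - √3 / 2) * l * κ) * Real.exp (√3 / 2 * κ * l) := by
    rw [← Real.exp_add]; ring_nf
  have h3 : (2 * K + 1) * B * Real.exp (√3 / 2 * κ * l) < Real.exp (κ * l) / (6 * κ ^ 2) := by
    rw [lt_div_iff₀ (by positivity), hexp]
    have h4 : 6 * (2 * K + 1) * B * κ ^ 2 < Real.exp ((1 - √3 / 2) * l * κ) := by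
      have : 0 < κ ^ 2 := by positivity
      linarith
    have := mul_lt_mul_of_pos_right h4 (Real.exp_pos (√3 / 2 * κ * l))
    linarith
  have h5 := mul_le_mul_of_nonneg_left hreal hK
  linarith

end

/-! ### Hadamard factorization for simple zeros -/

/-- An entire function that does not vanish at the origin has finitely many zeros in a disc. -/
theorem finite_zeros_closedBall {f : ℂ → ℂ} (hf : Differentiable ℂ f) (h0 : f 0 ≠ 0) (R : ℝ) :
    {a : ℂ | f a = 0 ∧ ‖a‖ ≤ R}.Finite := by
  by_contra hinf
  obtain ⟨x, -, hx⟩ := Set.Infinite.exists_accPt_of_subset_isCompact hinf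
    (isCompact_closedBall (0 : ℂ) R) (fun a ha => by simpa using ha.2)
  have hfreq : ∃ᶠ z in nhdsWithin x {x}ᶜ, f z = 0 :=
    (accPt_iff_frequently_nhdsNE.1 hx).mono fun z hz => hz.1
  have han : AnalyticOnNhd ℂ f Set.univ := hf.differentiableOn.analyticOnNhd isOpen_univ
  exact h0 (han.eqOn_zero_of_preconnected_of_frequently_eq_zero isPreconnected_univ
    (Set.mem_univ x) hfreq (Set.mem_univ 0))

/-- Division of an entire function by finitely many of its zeros. -/
theorem exists_factor_zeros {f : ℂ → ℂ} (hf : Differentiable ℂ f) (S : Finset ℂ)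
    (hS : ∀ a ∈ S, a ≠ 0 ∧ f a = 0) :
    ∃ g : ℂ → ℂ, Differentiable ℂ g ∧ ∀ z, f z = (∏ a ∈ S, (1 - z / a)) * g z := by
  classical
  induction S using Finset.induction_on with
  | empty => exact ⟨f, hf, fun z => by simp⟩
  | insert a S ha ih =>
    obtain ⟨g, hg, hfg⟩ := ih fun b hb => hS b (Finset.mem_insert_of_mem hb)
    obtain ⟨ha0, hfa⟩ := hS a (Finset.mem_insert_self a S)
    have hga : g a = 0 := by
      have h := hfg a
      rw [hfa] at h
      refine (mul_eq_zero.1 h.symm).resolve_left (Finset.prod_ne_zero_iff.2 fun b hb => ?_)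
      have hb0 := (hS b (Finset.mem_insert_of_mem hb)).1
      rw [sub_ne_zero]
      intro h1
      rw [eq_div_iff hb0, one_mul] at h1
      exact ha (h1 ▸ hb)
    -- As $g(a)=0$, the slope is $g(z)/(z-a)$ off $a$; the factor $-a$ normalizes $z-a$ to $1-z/a$.
    refine ⟨fun z => -a * dslope g a z, ?_, fun z => ?_⟩
    · have : Differentiable ℂ (dslope g a) := by
        rw [← differentiableOn_univ, differentiableOn_dslope Filter.univ_mem,
          differentiableOn_univ]
        exact hg
      exact this.const_mul _
    · have h1 : (z - a) * dslope g a z = g z := by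
        have := sub_smul_dslope g a z
        rwa [smul_eq_mul, hga, sub_zero] at this
      rw [Finset.prod_insert ha, hfg z, ← h1]
      field_simp
      ring

/-- After division by all its zeros in a disc, a function with simple zeros has no zero there. -/
theorem factor_ne_zero {f g : ℂ → ℂ} (hg : Differentiable ℂ g)
    (hsimple : ∀ w, f w = 0 → deriv f w ≠ 0) {S : Finset ℂ} (hS : ∀ a ∈ S, a ≠ 0)
    (hfg : ∀ z, f z = (∏ a ∈ S, (1 - z / a)) * g z) {w : ℂ} (hw : f w = 0 → w ∈ S) : g w ≠ 0 := by
  classical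
  intro hgw
  have hfw : f w = 0 := by rw [hfg, hgw, mul_zero]
  have hwS := hw hfw
  apply hsimple w hfw
  -- If $g(w)=0$ as well, $w$ would be at least a double zero of $f$; with $1-z/w$ split off, the
  -- derivative of $f$ at $w$ vanishes.
  have hP : Differentiable ℂ fun z => ∏ a ∈ S.erase w, (1 - z / a) := by fun_prop
  have hform : f = fun z => (1 - z / w) * ((∏ a ∈ S.erase w, (1 - z / a)) * g z) := by
    ext z
    rw [hfg z, ← Finset.mul_prod_erase S _ hwS, mul_assoc]
  have h1 : HasDerivAt (fun z : ℂ => 1 - z / w) (-(1 / w)) w :=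
    ((hasDerivAt_id w).div_const w).const_sub 1
  have h2 := ((hP w).mul (hg w)).hasDerivAt
  have h3 := h1.mul h2
  rw [hform]
  have h4 := h3.deriv
  have hww : 1 - w / w = 0 := by rw [div_self (hS w hwS), sub_self]
  simp only [Pi.mul_apply, hgw, mul_zero, hww, zero_mul, add_zero] at h4
  exact h4

/-- A holomorphic logarithm on a disc. -/
theorem exists_log_of_ne_zero {g : ℂ → ℂ} (hg : Differentiable ℂ g) {R : ℝ} (hR : 0 < R)
    (hne : ∀ z ∈ Metric.ball (0 : ℂ) R, g z ≠ 0) :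
    ∃ h : ℂ → ℂ, DifferentiableOn ℂ h (Metric.ball 0 R) ∧ h 0 = 0 ∧
      ∀ z ∈ Metric.ball (0 : ℂ) R, g z = g 0 * exp (h z) := by
  have hd : DifferentiableOn ℂ (fun z => deriv g z / g z) (Metric.ball 0 R) :=
    hg.deriv.differentiableOn.div hg.differentiableOn hne
  obtain ⟨h, h0, hh⟩ := hd.isExactOn_ball.with_val_at 0 0
  refine ⟨h, fun z hz => (hh z hz).differentiableAt.differentiableWithinAt, h0, fun z hz => ?_⟩
  have hconst : ∀ z ∈ Metric.ball (0 : ℂ) R, HasDerivAt (fun z => g z * exp (-h z)) 0 z := by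
    intro z hz
    have h1 := (hg z).hasDerivAt.mul (hh z hz).neg.cexp
    have h2 : deriv g z * exp ((-h) z) + g z * (exp ((-h) z) * -(deriv g z / g z)) = 0 := by
      field_simp [hne z hz]
      ring
    rw [h2] at h1
    exact h1
  have hc := (convex_ball (0 : ℂ) R).is_const_of_fderivWithin_eq_zero (𝕜 := ℂ)
    (f := fun z => g z * exp (-h z))
    (fun z hz => (hconst z hz).differentiableAt.differentiableWithinAt)
    (fun z hz => by
      rw [fderivWithin_of_isOpen Metric.isOpen_ball hz]
      have := (hconst z hz).hasFDerivAt.fderiv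
      rw [this]
      ext
      simp) hz (Metric.mem_ball_self hR)
  simp only [h0, neg_zero, exp_zero, mul_one] at hc
  rw [← hc, mul_assoc, ← exp_add, neg_add_cancel, exp_zero, mul_one]

/-- Bound for the quotient of an entire function by its zeros in a disc, by the maximum
principle. -/
theorem norm_factor_le {f g : ℂ → ℂ} (hg : Differentiable ℂ g) {R A : ℝ} (hR : 0 < R)
    {S : Finset ℂ} (hS : ∀ a ∈ S, a ≠ 0 ∧ ‖a‖ ≤ R)
    (hfg : ∀ z, f z = (∏ a ∈ S, (1 - z / a)) * g z)
    (hA : ∀ z, ‖z‖ = 3 * R → ‖f z‖ ≤ A) {w : ℂ} (hw : ‖w‖ ≤ 3 * R) :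
    2 ^ S.card * ‖g w‖ ≤ A := by
  -- On $|z|=3R$ each factor with $|a|\le R$ has modulus at least $3-1=2$. The resulting power of
  -- $2$ later bounds the number of zeros.
  have hsphere : ∀ z ∈ frontier (Metric.ball (0 : ℂ) (3 * R)), ‖g z‖ ≤ A / 2 ^ S.card := by
    intro z hz
    rw [frontier_ball _ (by positivity), mem_sphere_zero_iff_norm] at hz
    rw [le_div_iff₀ (by positivity), mul_comm]
    refine le_trans ?_ (hA z hz)
    rw [hfg z, norm_mul, norm_prod]
    refine mul_le_mul_of_nonneg_right ?_ (norm_nonneg _)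
    rw [← Finset.prod_const]
    refine Finset.prod_le_prod (fun _ _ => by norm_num) fun a ha => ?_
    obtain ⟨ha0, haR⟩ := hS a ha
    have h1 := norm_sub_norm_le (z / a) 1
    rw [norm_div, hz, norm_one, norm_sub_rev] at h1
    have : 3 ≤ 3 * R / ‖a‖ := by
      rw [le_div_iff₀ (norm_pos_iff.2 ha0)]
      linarith
    linarith
  have := norm_le_of_forall_mem_frontier_norm_le Metric.isBounded_ball hg.diffContOnCl hsphere
    (z := w) (by rwa [closure_ball _ (by positivity), mem_closedBall_zero_iff])
  rw [le_div_iff₀ (by positivity)] at this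
  linarith

/-- **Hadamard's factorization** for entire functions of order at most `1/3` with simple zeros: the
partial products over the zeros in growing discs converge; and a bound for the number of
zeros. -/
theorem hadamard_simple_zeros {f : ℂ → ℂ} (hf : Differentiable ℂ f) (h0 : f 0 ≠ 0)
    (hsimple : ∀ w, f w = 0 → deriv f w ≠ 0) {B l : ℝ} (hl : 0 ≤ l)
    (hB : ∀ z, ‖f z‖ ≤ B * Real.exp (‖z‖ ^ (1 / 3 : ℝ) * l)) {Z : ℝ → Finset ℂ}
    (hZ : ∀ R a, a ∈ Z R ↔ f a = 0 ∧ ‖a‖ ≤ R) :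
    (∀ R, 0 < R → 2 ^ (Z R).card * ‖f 0‖ ≤ B * Real.exp ((3 * R) ^ (1 / 3 : ℝ) * l)) ∧
    ∀ z, Filter.Tendsto (fun R => ∏ a ∈ Z R, (1 - z / a)) Filter.atTop (nhds (f z / f 0)) := by
  have hne : ∀ R, ∀ a ∈ Z R, a ≠ 0 := fun R a ha h =>
    h0 (h ▸ ((hZ R a).1 ha).1)
  choose g hg hfg using fun R => exists_factor_zeros hf (Z R)
    fun a ha => ⟨hne R a ha, ((hZ R a).1 ha).1⟩
  have hg0 : ∀ R, g R 0 = f 0 := fun R => by simp [hfg R 0]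
  have hmax : ∀ R, 0 < R → ∀ w, ‖w‖ ≤ 3 * R →
      2 ^ (Z R).card * ‖g R w‖ ≤ B * Real.exp ((3 * R) ^ (1 / 3 : ℝ) * l) := by
    intro R hR w hw
    refine norm_factor_le (hg R) hR (fun a ha => ⟨hne R a ha, ((hZ R a).1 ha).2⟩) (hfg R)
      (fun z hz => ?_) hw
    rw [← hz]
    exact hB z
  have hB0 : ‖f 0‖ ≤ B := by
    have := hB 0
    rwa [norm_zero, Real.zero_rpow (by norm_num), zero_mul, Real.exp_zero, mul_one] at this
  have hf0 : 0 < ‖f 0‖ := norm_pos_iff.2 h0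
  have hBpos : 0 < B := hf0.trans_le hB0
  refine ⟨fun R hR => by simpa [hg0] using hmax R hR 0 (by simp; positivity), fun z => ?_⟩
  -- Majorant of the real part of the logarithm of $g_R/f(0)$ on the disc; the $+1$ ensures the
  -- positivity required by Borel–Carathéodory.
  set m : ℝ → ℝ := fun R => Real.log (B / ‖f 0‖) + 1 + (3 * R) ^ (1 / 3 : ℝ) * l with hm
  have hlog : 0 ≤ Real.log (B / ‖f 0‖) := Real.log_nonneg (by rwa [one_le_div hf0])
  have hbound : ∀ R, ‖z‖ < R → ∃ h : ℂ, g R z = f 0 * exp h ∧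
      ‖h‖ ≤ 2 * m R * ‖z‖ / (R - ‖z‖) := by
    intro R hzR
    have hR : 0 < R := (norm_nonneg z).trans_lt hzR
    have hgne : ∀ w ∈ Metric.ball (0 : ℂ) R, g R w ≠ 0 := fun w hw =>
      factor_ne_zero (hg R) hsimple (hne R) (hfg R)
        fun hfw => (hZ R w).2 ⟨hfw, (mem_ball_zero_iff.1 hw).le⟩
    obtain ⟨h, hd, hh0, hexp⟩ := exists_log_of_ne_zero (hg R) hR hgne
    refine ⟨h z, by rw [hexp z (mem_ball_zero_iff.2 hzR), hg0], ?_⟩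
    have hmpos : 0 < m R := by positivity
    refine borelCaratheodory_zero hmpos hd (fun w hw => ?_) hR (mem_ball_zero_iff.2 hzR) hh0
    have h1 := hmax R hR w (by have := mem_ball_zero_iff.1 hw; linarith)
    have h2 : ‖g R w‖ ≤ B * Real.exp ((3 * R) ^ (1 / 3 : ℝ) * l) := by
      refine le_trans ?_ h1
      exact le_mul_of_one_le_left (norm_nonneg _) (one_le_pow₀ (by norm_num))
    rw [hexp w hw, hg0, norm_mul, norm_exp] at h2
    have h3 : Real.exp (h w).re
        ≤ Real.exp (Real.log (B / ‖f 0‖) + (3 * R) ^ (1 / 3 : ℝ) * l) := by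
      rw [Real.exp_add, Real.exp_log (by positivity), div_mul_eq_mul_div, le_div_iff₀ hf0]
      linarith
    have h4 := Real.exp_le_exp.1 h3
    change (h w).re ≤ m R
    simp only [hm]
    linarith
  -- Order below $1$ enters here: $m(R)=O(R^{1/3})=o(R)$, so the quotients $g_R$ tend to the
  -- constant $f(0)$ and no exponential factor remains.
  have hlim : Filter.Tendsto (fun R => 2 * m R * ‖z‖ / (R - ‖z‖)) Filter.atTop (nhds 0) := by
    have t1 : Filter.Tendsto (fun R : ℝ => m R / R) Filter.atTop (nhds 0) := by
      have a1 : Filter.Tendsto (fun R : ℝ => (Real.log (B / ‖f 0‖) + 1) / R) Filter.atTop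
        (nhds 0) := Filter.tendsto_id.const_div_atTop _
      have a2 : Filter.Tendsto (fun R : ℝ => (3 ^ (1 / 3 : ℝ) * l) * R ^ (-(2 / 3 : ℝ)))
          Filter.atTop (nhds ((3 ^ (1 / 3 : ℝ) * l) * 0)) :=
        (tendsto_rpow_neg_atTop (by norm_num : (0 : ℝ) < 2 / 3)).const_mul _
      have a3 := a1.add a2
      rw [mul_zero, add_zero] at a3
      refine a3.congr' ?_
      filter_upwards [Filter.eventually_gt_atTop 0] with R hR
      have : R ^ (-(2 / 3 : ℝ)) = R ^ (1 / 3 : ℝ) / R := by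
        rw [← Real.rpow_sub_one hR.ne']; norm_num
      rw [this, hm]
      simp only
      rw [Real.mul_rpow (by norm_num) hR.le]
      ring
    have t2 : Filter.Tendsto (fun R : ℝ => 1 - ‖z‖ / R) Filter.atTop (nhds (1 - 0)) :=
      (Filter.tendsto_id.const_div_atTop _).const_sub 1
    have t3 := ((t1.const_mul 2).mul_const ‖z‖).div t2 (by norm_num)
    simp only [mul_zero, zero_mul, sub_zero, zero_div] at t3
    refine t3.congr' ?_
    filter_upwards [Filter.eventually_gt_atTop ‖z‖] with R hR
    have hR0 : R ≠ 0 := ((norm_nonneg z).trans_lt hR).ne'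
    have : R - ‖z‖ ≠ 0 := by linarith
    simp only [Pi.div_apply]
    field_simp
  have hglim : Filter.Tendsto (fun R => g R z) Filter.atTop (nhds (f 0)) := by
    choose! h hh hhb using hbound
    have hh0 : Filter.Tendsto h Filter.atTop (nhds 0) := by
      refine squeeze_zero_norm' ?_ hlim
      filter_upwards [Filter.eventually_gt_atTop ‖z‖] with R hR
      exact hhb R hR
    have h2 := ((continuous_exp.tendsto 0).comp hh0).const_mul (f 0)
    rw [exp_zero, mul_one] at h2
    refine h2.congr' ?_
    filter_upwards [Filter.eventually_gt_atTop ‖z‖] with R hR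
    exact (hh R hR).symm
  have hq := (tendsto_const_nhds (x := f z)).div hglim h0
  refine hq.congr' ?_
  filter_upwards [hglim.eventually_ne h0] with R hR
  simp only [Pi.div_apply]
  rw [hfg R z, mul_div_assoc, div_self hR, mul_one]

/-! ### Zeros on both half-lines, enumeration and the product -/

section

variable {q : ℝ → ℝ} {l : ℝ}

/-- Every real number is a cube. -/
theorem exists_cube_eq (b : ℝ) : ∃ x : ℝ, x ^ 3 = b := by
  have h : ∀ b : ℝ, 0 ≤ b → (b ^ (1 / 3 : ℝ)) ^ 3 = b := fun b hb => by
    rw [← Real.rpow_natCast, ← Real.rpow_mul hb]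
    norm_num
  rcases le_total 0 b with hb | hb
  · exact ⟨_, h b hb⟩
  · exact ⟨-(-b) ^ (1 / 3 : ℝ), by rw [Odd.neg_pow (by decide), h (-b) (by linarith), neg_neg]⟩

theorem injective_ofReal_cube : Function.Injective fun x : ℝ => (x : ℂ) ^ 3 := by
  intro x y hxy
  simp only at hxy
  have : x ^ 3 = y ^ 3 := by exact_mod_cast hxy
  exact (Odd.strictMono_pow (n := 3) (by decide)).injective this

/-- The real zeros of the characteristic function extend to infinity in both directions. -/
theorem exists_zero_beyond (hl : 0 < l) (hq : MemLp q 2 (volume.restrict (Set.Ioo 0 l)))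
    {θ : ℂ} (hθ : ‖θ‖ = 1) (h0 : specFun q l θ 0 ≠ 0) {σ : ℝ} (hσ : |σ| = 1) (R : ℝ) :
    ∃ x : ℝ, specFun q l θ ((x : ℂ) ^ 3) = 0 ∧ R < σ * x := by
  classical
  by_contra! hcon
  obtain ⟨B, hB0, hB⟩ := exists_specFun_bound hl.le hq
  have hf := differentiable_specFun hl.le hq θ
  set f := specFun q l θ with hfdef
  set Z : ℝ → Finset ℂ := fun R => (finite_zeros_closedBall hf h0 R).toFinset with hZdef
  have hZ : ∀ R a, a ∈ Z R ↔ f a = 0 ∧ ‖a‖ ≤ R := fun R a => by simp [hZdef]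
  have hlim := (hadamard_simple_zeros hf h0 (fun w hw => deriv_specFun_ne_zero hl hq hθ hw) hl.le
    (fun z => hB θ z hθ) hZ).2
  set R₁ : ℝ := |R| with hR1
  -- A finite set which, under the negated claim, contains every zero on the half-line of sign
  -- $\sigma$.
  set P := Z (R₁ ^ 3) with hP
  have hσσ : σ * σ = 1 := by rw [← abs_mul_abs_self, hσ, one_mul]
  have hreal : ∀ a, f a = 0 → ∃ b : ℝ, (b : ℂ) = a ∧ b ≠ 0 ∧ (0 < σ * b → a ∈ P) := by
    intro a ha
    have him := im_eq_zero_of_specFun_eq_zero hl hq hθ ha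
    have hare : (a.re : ℂ) = a := Complex.ext (by simp) (by simp [him])
    refine ⟨a.re, hare, fun h => ?_, fun hpos => ?_⟩
    · rw [h, ofReal_zero] at hare
      exact h0 (hare ▸ ha)
    · obtain ⟨x, hx⟩ := exists_cube_eq a.re
      have hxa : (x : ℂ) ^ 3 = a := by rw [← hare, ← hx]; push_cast; rfl
      have hle := hcon x (by rw [hxa]; exact ha)
      have hσx : (σ * x) ^ 3 = σ * a.re := by
        rw [← hx]; linear_combination σ * x ^ 3 * hσσ
      have hpx : 0 < σ * x := by
        by_contra hneg
        push Not at hneg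
        have : (σ * x) ^ 3 ≤ 0 := Odd.pow_nonpos (by decide) hneg
        linarith
      refine (hZ _ _).2 ⟨ha, ?_⟩
      rw [← hxa, norm_pow, norm_real, Real.norm_eq_abs]
      have : |x| = σ * x := by
        rw [← abs_of_pos hpx, abs_mul, hσ, one_mul]
      rw [this]
      exact pow_le_pow_left₀ hpx.le (hle.trans (le_abs_self R)) 3
  obtain ⟨κ, hκ⟩ := ((eventually_specFun_real_lt_imag hl hq hθ
    (K := 3 ^ P.card) (by positivity)).and ((Filter.eventually_gt_atTop 0).and
      ((Filter.tendsto_pow_atTop (α := ℝ) three_ne_zero).eventually_ge_atTop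
        (2 * R₁ ^ 3)))).exists
  obtain ⟨hdom, hκ0, hκ2⟩ := hκ
  have hd := hdom (σ * κ) (by rw [abs_mul, hσ, one_mul, abs_of_pos hκ0])
  set y := κ ^ 3 with hy
  have hy0 : 0 < y := by positivity
  have hz1 : ((σ * κ : ℝ) : ℂ) ^ 3 = ((σ * y : ℝ) : ℂ) := by
    have : (σ * κ) ^ 3 = σ * y := by
      rw [hy]; linear_combination σ * κ ^ 3 * hσσ
    rw [← this]; push_cast; rfl
  have hz2 : I * (κ : ℂ) ^ 3 = I * (y : ℂ) := by rw [hy]; push_cast; rfl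
  rw [hz1, hz2] at hd
  -- For a zero $b$ of sign opposite to $\sigma$, $|1-iy/b|\le1+y/|b|=|1-\sigma y/b|$. On the same
  -- side $t=y/|b|\ge2$, and $1+t\le3(t-1)$ explains the factor $3$, paid only on $P$.
  have hterm : ∀ a, f a = 0 → ‖1 - I * (y : ℂ) / a‖
      ≤ (if a ∈ P then 3 else 1) * ‖1 - ((σ * y : ℝ) : ℂ) / a‖ := by
    intro a ha
    obtain ⟨b, rfl, hb0, hbP⟩ := hreal a ha
    have hbpos : 0 < |b| := abs_pos.2 hb0
    have hup : ‖1 - I * (y : ℂ) / b‖ ≤ 1 + y / |b| := by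
      refine (norm_sub_le _ _).trans ?_
      simp [abs_of_pos hy0]
    have hre : ‖1 - ((σ * y : ℝ) : ℂ) / b‖ = |1 - σ * y / b| := by
      rw [← ofReal_div, ← ofReal_one, ← ofReal_sub, norm_real, Real.norm_eq_abs]
    rw [hre]
    rcases lt_or_gt_of_ne (show σ * b ≠ 0 from mul_ne_zero (by
        intro h; rw [h, abs_zero] at hσ; norm_num at hσ) hb0) with hs | hs
    · have hab : |b| = -(σ * b) := by
        rw [← abs_of_neg hs, abs_mul, hσ, one_mul]
      have e : σ * y / b = -(y / |b|) := by
        rw [hab, div_neg, neg_neg, div_eq_div_iff hb0 hs.ne]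
        linear_combination y * b * hσσ
      have hyb : 0 < y / |b| := by positivity
      have h1 : 1 + y / |b| = |1 - σ * y / b| := by
        rw [e, sub_neg_eq_add]
        exact (abs_of_pos (by linarith)).symm
      rw [← h1]
      refine hup.trans (le_mul_of_one_le_left (by positivity) ?_)
      split_ifs <;> norm_num
    · have haP := hbP hs
      have hab : |b| = σ * b := by
        rw [← abs_of_pos hs, abs_mul, hσ, one_mul]
      have e : σ * y / b = y / |b| := by
        rw [hab, div_eq_div_iff hb0 hs.ne']
        linear_combination y * b * hσσ
      have hbR : |b| ≤ R₁ ^ 3 := by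
        have := ((hZ _ _).1 haP).2
        rwa [norm_real, Real.norm_eq_abs] at this
      have h2 : 2 ≤ y / |b| := by
        rw [le_div_iff₀ hbpos]
        linarith
      rw [if_pos haP, e, abs_of_nonpos (by linarith)]
      linarith
  have hprod : ∀ R', ‖∏ a ∈ Z R', (1 - I * (y : ℂ) / a)‖
      ≤ 3 ^ P.card * ‖∏ a ∈ Z R', (1 - ((σ * y : ℝ) : ℂ) / a)‖ := by
    intro R'
    rw [norm_prod, norm_prod]
    refine (Finset.prod_le_prod (fun _ _ => norm_nonneg _)
      fun a ha => hterm a ((hZ _ _).1 ha).1).trans ?_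
    rw [Finset.prod_mul_distrib]
    refine mul_le_mul_of_nonneg_right ?_ (Finset.prod_nonneg fun _ _ => norm_nonneg _)
    rw [Finset.prod_ite, Finset.prod_const, Finset.prod_const_one, mul_one]
    refine pow_le_pow_right₀ (by norm_num) (Finset.card_le_card fun a ha => ?_)
    exact (Finset.mem_filter.1 ha).2
  have hle := le_of_tendsto_of_tendsto (hlim (I * y)).norm
    ((hlim ((σ * y : ℝ) : ℂ)).norm.const_mul (3 ^ P.card)) (Filter.Eventually.of_forall hprod)
  rw [norm_div, norm_div, ← mul_div_assoc,
    div_le_div_iff_of_pos_right (norm_pos_iff.2 h0)] at hle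
  exact absurd hle (not_le.2 hd)

/-- A locally finite set of reals, unbounded in both directions, can be enumerated by `ℤ`. -/
theorem exists_isAscendingEnumeration {X : Set ℝ} (hfin : ∀ R : ℝ, (X ∩ Set.Icc (-R) R).Finite)
    (hup : ∀ R : ℝ, ∃ x ∈ X, R < x) (hdown : ∀ R : ℝ, ∃ x ∈ X, x < R) :
    ∃ μ : ℤ → ℝ, IsAscendingEnumeration X μ := by
  have hIcc : ∀ a b : X, (Set.Icc a b).Finite := by
    intro a b
    refine Set.Finite.of_finite_image (f := Subtype.val) ?_ Subtype.val_injective.injOn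
    refine (hfin (max |(a : ℝ)| |(b : ℝ)|)).subset ?_
    rintro _ ⟨c, ⟨hac, hcb⟩, rfl⟩
    have h1 : (a : ℝ) ≤ c := hac
    have h2 : (c : ℝ) ≤ b := hcb
    exact ⟨c.2, by linarith [neg_abs_le (a : ℝ), le_max_left |(a : ℝ)| |(b : ℝ)|],
      by linarith [le_abs_self (b : ℝ), le_max_right |(a : ℝ)| |(b : ℝ)|]⟩
  let _ : LocallyFiniteOrder X := LocallyFiniteOrder.ofFiniteIcc hIcc
  let _ : SuccOrder X := LinearLocallyFiniteOrder.succOrder X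
  let _ : PredOrder X := LinearLocallyFiniteOrder.predOrder X
  have : NoMaxOrder X := ⟨fun a => by
    obtain ⟨x, hx, hax⟩ := hup a
    exact ⟨⟨x, hx⟩, hax⟩⟩
  have : NoMinOrder X := ⟨fun a => by
    obtain ⟨x, hx, hax⟩ := hdown a
    exact ⟨⟨x, hx⟩, hax⟩⟩
  obtain ⟨r, hrX, hr⟩ := hup 0
  have : Nonempty X := ⟨⟨r, hrX⟩⟩
  set e : X ≃o ℤ := orderIsoIntOfLinearSuccPredArch
  obtain ⟨m, hm⟩ : ∃ m, IsLeast {x | x ∈ X ∧ 0 ≤ x} m := by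
    have hf : (X ∩ Set.Icc 0 r).Finite :=
      (hfin r).subset fun x hx => ⟨hx.1, by linarith [hx.2.1], hx.2.2⟩
    obtain ⟨m, hm, hmin⟩ := Set.exists_min_image _ id hf ⟨r, hrX, hr.le, le_rfl⟩
    refine ⟨m, ⟨hm.1, hm.2.1⟩, fun x hx => ?_⟩
    rcases le_total x r with h | h
    · exact hmin x ⟨hx.1, hx.2, h⟩
    · exact hm.2.2.trans h
  -- A locally finite linear order without end points is isomorphic to $\mathbb Z$; the shift places
  -- its least non-negative element at index $0$.
  refine ⟨fun n => (e.symm (n + e ⟨m, hm.1.1⟩) : X), ⟨?_, ?_, ?_⟩⟩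
  · intro a b hab
    exact e.symm.strictMono (by simpa using hab)
  · ext x
    constructor
    · rintro ⟨n, rfl⟩
      exact Subtype.coe_prop _
    · intro hx
      exact ⟨e ⟨x, hx⟩ - e ⟨m, hm.1.1⟩, by simp⟩
  · simpa using hm

/-- Summability of the reciprocal cubes of a sequence with linear counting function. -/
theorem summable_inv_cube_of_counting {X : Set ℝ} {μ : ℤ → ℝ} (hμ : IsAscendingEnumeration X μ)
    (h0 : (0 : ℝ) ∉ X) {c : ℝ}
    (hc : ∀ (r : ℝ) (T : Finset ℤ), 0 < r → (∀ n ∈ T, |μ n| ≤ r) → (T.card : ℝ) ≤ c * (1 + r)) :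
    Summable fun n => |1 / μ n ^ 3| := by
  have hne : ∀ n, μ n ≠ 0 := fun n h => h0 (by
    rw [← hμ.range_eq, ← h]; exact Set.mem_range_self n)
  have hneg : ∀ m : ℤ, m < 0 → μ m < 0 := by
    intro m hm
    by_contra! h
    have h1 := hμ.isLeast_zero.2 ⟨hμ.range_eq ▸ Set.mem_range_self m, h⟩
    exact absurd h1 (not_le.2 (hμ.strictMono hm))
  -- All $\mu_m$ with $0\le m\le n$, or with $n\le m<0$, have modulus at most $|\mu_n|$, because the
  -- sign of $\mu$ changes exactly at index $0$. Counting them gives $|\mu_n|$ at least linear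
  -- growth in $|n|$.
  have hcount : ∀ n : ℤ, |(n : ℝ)| ≤ c * (1 + |μ n|) := by
    intro n
    rcases le_or_gt 0 n with hn | hn
    · have := hc |μ n| (Finset.Icc 0 n) (abs_pos.2 (hne n)) fun m hm => by
        rw [Finset.mem_Icc] at hm
        have h1 := hμ.strictMono.monotone hm.1
        have h2 := hμ.strictMono.monotone hm.2
        have h3 := hμ.isLeast_zero.1.2
        exact abs_le_abs h2 (by linarith)
      rw [Int.card_Icc] at this
      refine le_trans ?_ this
      have hn' : ((n + 1 - 0).toNat : ℤ) = n + 1 := by omega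
      have : (((n + 1 - 0).toNat : ℤ) : ℝ) = n + 1 := by rw [hn']; push_cast; rfl
      rw [Int.cast_natCast] at this
      rw [this, abs_of_nonneg (by exact_mod_cast hn)]
      linarith
    · have := hc |μ n| (Finset.Ico n 0) (abs_pos.2 (hne n)) fun m hm => by
        rw [Finset.mem_Ico] at hm
        have h1 := hμ.strictMono.monotone hm.1
        have h2 := hneg m hm.2
        rw [abs_of_neg h2, abs_of_neg (hneg n hn)]
        linarith
      rw [Int.card_Ico] at this
      refine le_trans ?_ this
      have hn' : ((0 - n).toNat : ℤ) = -n := by omega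
      have : (((0 - n).toNat : ℤ) : ℝ) = -n := by rw [hn']; push_cast; rfl
      rw [Int.cast_natCast] at this
      rw [this, abs_of_neg (by exact_mod_cast hn)]
  have hc0 : 0 < c := by
    have h := hcount 1
    have h1 : 0 < 1 + |μ 1| := by positivity
    by_contra! hneg
    have := mul_nonpos_of_nonpos_of_nonneg hneg h1.le
    norm_num at h
    linarith
  have hs : Summable fun n : ℤ => (2 * c) ^ 3 * |1 / (n : ℝ) ^ 3| :=
    ((Real.summable_one_div_int_pow (p := 3)).2 (by norm_num)).abs.mul_left _
  refine Summable.of_norm_bounded_eventually hs ?_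
  obtain ⟨N, hN⟩ := exists_nat_gt (2 * c)
  have hfin : {n : ℤ | |n| ≤ N}.Finite :=
    (Set.finite_Icc (-(N : ℤ)) N).subset fun n hn => abs_le.1 hn
  refine hfin.subset fun n hn => ?_
  by_contra hnN
  apply hn
  simp only [Set.mem_ofPred_eq, not_le] at hnN
  have h1 : (N : ℝ) < |(n : ℝ)| := by exact_mod_cast hnN
  have hn0 : 0 < |(n : ℝ)| := by linarith
  have h2 : |(n : ℝ)| ≤ 2 * c * |μ n| := by
    have := hcount n
    linarith
  have hμn : 0 < |μ n| := abs_pos.2 (hne n)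
  change ‖|1 / μ n ^ 3|‖ ≤ (2 * c) ^ 3 * |1 / (n : ℝ) ^ 3|
  rw [Real.norm_eq_abs, abs_abs, abs_div, abs_div, abs_one, abs_pow, abs_pow,
    mul_one_div, div_le_div_iff₀ (by positivity) (by positivity), one_mul, ← mul_pow]
  exact pow_le_pow_left₀ hn0.le h2 3

/-- The number of zeros of the characteristic function grows at most linearly in `λ`. -/
theorem counting_bound {f : ℂ → ℂ} {B l : ℝ} (hl : 0 ≤ l) (h0 : f 0 ≠ 0) (hB0 : ‖f 0‖ ≤ B)
    {Z : ℝ → Finset ℂ} (hZ : ∀ R a, a ∈ Z R ↔ f a = 0 ∧ ‖a‖ ≤ R)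
    (hcard : ∀ R, 0 < R → 2 ^ (Z R).card * ‖f 0‖ ≤ B * Real.exp ((3 * R) ^ (1 / 3 : ℝ) * l))
    {μ : ℤ → ℝ} (hμ : Function.Injective μ) (hfμ : ∀ n, f ((μ n : ℂ) ^ 3) = 0) :
    ∃ c : ℝ, ∀ (r : ℝ) (T : Finset ℤ), 0 < r → (∀ n ∈ T, |μ n| ≤ r) →
      (T.card : ℝ) ≤ c * (1 + r) := by
  classical
  have hf0 : 0 < ‖f 0‖ := norm_pos_iff.2 h0
  have hlog : 0 ≤ Real.log (B / ‖f 0‖) := Real.log_nonneg (by rwa [one_le_div hf0])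
  have hlog2 : 0 < Real.log 2 := Real.log_pos (by norm_num)
  -- Take logarithms in the zero count for the disc of radius $R=r^3$, where $(3R)^{1/3}=3^{1/3}r$
  -- is linear in $r$.
  refine ⟨(Real.log (B / ‖f 0‖) + 3 ^ (1 / 3 : ℝ) * l) / Real.log 2, fun r T hr hT => ?_⟩
  have hinj : Function.Injective fun n : ℤ => (μ n : ℂ) ^ 3 := injective_ofReal_cube.comp hμ
  have h1 : T.card ≤ (Z (r ^ 3)).card := by
    rw [← Finset.card_image_of_injective T hinj]
    refine Finset.card_le_card fun a ha => ?_
    obtain ⟨n, hn, rfl⟩ := Finset.mem_image.1 ha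
    refine (hZ _ _).2 ⟨hfμ n, ?_⟩
    rw [norm_pow, norm_real, Real.norm_eq_abs]
    exact pow_le_pow_left₀ (abs_nonneg _) (hT n hn) 3
  have h2 := hcard (r ^ 3) (by positivity)
  have e : (3 * r ^ 3) ^ (1 / 3 : ℝ) = 3 ^ (1 / 3 : ℝ) * r := by
    rw [Real.mul_rpow (by norm_num) (by positivity), ← Real.rpow_natCast r 3,
      ← Real.rpow_mul hr.le]
    norm_num
  rw [e, ← le_div_iff₀ hf0, mul_div_right_comm] at h2
  have h3 : (2 : ℝ) ^ T.card ≤ B / ‖f 0‖ * Real.exp (3 ^ (1 / 3 : ℝ) * r * l) :=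
    (pow_le_pow_right₀ (by norm_num) h1).trans h2
  have hBf : 0 < B / ‖f 0‖ := div_pos (hf0.trans_le hB0) hf0
  have h4 := Real.log_le_log (by positivity) h3
  rw [Real.log_pow, Real.log_mul hBf.ne' (Real.exp_pos _).ne', Real.log_exp] at h4
  rw [div_mul_eq_mul_div, le_div_iff₀ hlog2]
  refine h4.trans ?_
  have h5 : 0 ≤ (3 : ℝ) ^ (1 / 3 : ℝ) * l := by positivity
  nlinarith [mul_nonneg hlog hr.le]

theorem aConst_eq (hl : 0 ≤ l) (hq : MemLp q 2 (volume.restrict (Set.Ioo 0 l))) :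
    aConst q l = specEnd q l 0 := by
  rw [aConst, fundSol_two_eq_specSol hl hq 0 ⟨hl, le_rfl⟩, specEnd]
  norm_num

/-- At $z=0$ the two terms of $F$ are $\bar a=a\theta_0$ and $\theta a$. This identifies the
constant in front of the product. -/
theorem specFun_zero (hl : 0 < l) (hq : MemLp q 2 (volume.restrict (Set.Ioo 0 l))) (θ : ℂ) :
    specFun q l θ 0 = -aConst q l * (θ + theta0 q l) := by
  have h := specEnd_ofReal_ne_zero hl hq 0
  rw [ofReal_zero, ← aConst_eq hl.le hq] at h
  rw [specFun, map_zero, ← aConst_eq hl.le hq, theta0]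
  field_simp
  ring

/-- The real zeros of the characteristic function are enumerated by `ℤ`, and it is the product of
its elementary factors. -/
theorem exists_enumeration_and_product (hl : 0 < l)
    (hq : MemLp q 2 (volume.restrict (Set.Ioo 0 l))) {θ : ℂ} (hθ : ‖θ‖ = 1)
    (h0 : specFun q l θ 0 ≠ 0) :
    ∃ μ : ℤ → ℝ, IsAscendingEnumeration (realZeros q l θ) μ ∧ ∀ lam : ℂ,
      Multipliable (fun n : ℤ => 1 - lam ^ 3 / (μ n : ℂ) ^ 3) ∧
      charFun q l θ lam = specFun q l θ 0 * ∏' n : ℤ, (1 - lam ^ 3 / (μ n : ℂ) ^ 3) := by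
  classical
  obtain ⟨B, -, hB⟩ := exists_specFun_bound hl.le hq
  have hf := differentiable_specFun hl.le hq θ
  have hX : realZeros q l θ = {x : ℝ | specFun q l θ ((x : ℂ) ^ 3) = 0} := by
    ext x
    simp only [realZeros, charFun_eq_specFun hl hq]
  have hup := exists_zero_beyond hl hq hθ h0 (σ := 1) (by norm_num)
  have hdown := exists_zero_beyond hl hq hθ h0 (σ := -1) (by norm_num)
  have hrealz : ∀ a, specFun q l θ a = 0 → ∃ x : ℝ, (x : ℂ) ^ 3 = a := by
    intro a ha
    obtain ⟨x, hx⟩ := exists_cube_eq a.re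
    refine ⟨x, ?_⟩
    rw [← ofReal_pow, hx]
    exact Complex.ext (by simp) (by simp [im_eq_zero_of_specFun_eq_zero hl hq hθ ha])
  have hsimple := fun w (hw : specFun q l θ w = 0) => deriv_specFun_ne_zero hl hq hθ hw
  simp only [charFun_eq_specFun hl hq]
  set f := specFun q l θ with hfdef
  set Z : ℝ → Finset ℂ := fun R => (finite_zeros_closedBall hf h0 R).toFinset with hZdef
  have hZ : ∀ R a, a ∈ Z R ↔ f a = 0 ∧ ‖a‖ ≤ R := fun R a => by simp [hZdef]
  obtain ⟨hcard, hlim⟩ := hadamard_simple_zeros hf h0 hsimple hl.le (fun z => hB θ z hθ) hZ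
  obtain ⟨μ, hμ⟩ : ∃ μ : ℤ → ℝ, IsAscendingEnumeration (realZeros q l θ) μ := by
    rw [hX]
    refine exists_isAscendingEnumeration (fun R => ?_) (fun R => ?_) (fun R => ?_)
    · refine Set.Finite.of_finite_image (f := fun x : ℝ => (x : ℂ) ^ 3) ?_ injective_ofReal_cube.injOn
      refine (finite_zeros_closedBall hf h0 (R ^ 3)).subset ?_
      rintro _ ⟨x, ⟨hx, hxR⟩, rfl⟩
      refine ⟨hx, ?_⟩
      rw [norm_pow, norm_real, Real.norm_eq_abs]
      exact pow_le_pow_left₀ (abs_nonneg _) (abs_le.2 hxR) 3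
    · obtain ⟨x, hx, hRx⟩ := hup R
      exact ⟨x, hx, by linarith⟩
    · obtain ⟨x, hx, hRx⟩ := hdown (-R)
      exact ⟨x, hx, by linarith⟩
  have hμX : ∀ n, f ((μ n : ℂ) ^ 3) = 0 := by
    intro n
    have : μ n ∈ realZeros q l θ := hμ.range_eq ▸ Set.mem_range_self n
    rw [hX] at this
    exact this
  have hB0 : ‖f 0‖ ≤ B := by
    have := hB θ 0 hθ
    rwa [norm_zero, Real.zero_rpow (by norm_num), zero_mul, Real.exp_zero, mul_one] at this
  obtain ⟨c, hc⟩ := counting_bound hl.le h0 hB0 hZ hcard hμ.strictMono.injective hμX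
  have h0X : (0 : ℝ) ∉ realZeros q l θ := by
    rw [hX]
    intro h
    exact h0 (by simpa using h)
  have hsum := summable_inv_cube_of_counting hμ h0X hc
  refine ⟨μ, hμ, fun lam => ?_⟩
  have hmult : Multipliable fun n : ℤ => 1 - lam ^ 3 / (μ n : ℂ) ^ 3 := by
    have := multipliable_one_add_of_summable (f := fun n : ℤ => -(lam ^ 3 / (μ n : ℂ) ^ 3)) (by
      refine (hsum.mul_left (‖lam‖ ^ 3)).congr fun n => ?_
      rw [norm_neg, norm_div, norm_pow, norm_pow, norm_real, Real.norm_eq_abs, abs_div, abs_one,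
        abs_pow, mul_one_div])
    simpa only [← sub_eq_add_neg] using this
  refine ⟨hmult, ?_⟩
  have hinj : Function.Injective fun n : ℤ => (μ n : ℂ) ^ 3 :=
    injective_ofReal_cube.comp hμ.strictMono.injective
  set T : ℝ → Finset ℤ := fun R => (Z R).preimage (fun n : ℤ => (μ n : ℂ) ^ 3) hinj.injOn with hT
  -- The index sets of growing discs exhaust $\mathbb Z$, so the unconditional product can be
  -- evaluated along them. Since every zero of $F$ is the cube of some $\mu_n$, these partial
  -- products are those of the Hadamard limit.
  have hTtop : Filter.Tendsto T Filter.atTop Filter.atTop := by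
    rw [Filter.tendsto_atTop]
    intro S
    obtain ⟨M, hM⟩ := (S.image fun n => ‖(μ n : ℂ) ^ 3‖).bddAbove
    filter_upwards [Filter.eventually_ge_atTop M] with R hR
    intro n hn
    rw [hT, Finset.mem_preimage, hZ]
    exact ⟨hμX n, (hM (by simpa using ⟨n, hn, rfl⟩)).trans hR⟩
  have hprod : ∀ R, ∏ n ∈ T R, (1 - lam ^ 3 / (μ n : ℂ) ^ 3) = ∏ a ∈ Z R, (1 - lam ^ 3 / a) := by
    intro R
    refine Finset.prod_preimage _ (Z R) hinj.injOn (fun a => 1 - lam ^ 3 / a) fun a ha hna => ?_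
    exfalso
    apply hna
    obtain ⟨x, hx⟩ := hrealz a ((hZ R a).1 ha).1
    have hxX : x ∈ realZeros q l θ := by
      rw [hX]
      change f ((x : ℂ) ^ 3) = 0
      rw [hx]
      exact ((hZ R a).1 ha).1
    rw [← hμ.range_eq] at hxX
    obtain ⟨n, rfl⟩ := hxX
    exact ⟨n, hx⟩
  have h1 := hmult.hasProd
  rw [HasProd, SummationFilter.unconditional_filter] at h1
  replace h1 := h1.comp hTtop
  have h2 := hlim (lam ^ 3)
  have h3 := tendsto_nhds_unique (h1.congr hprod) h2
  rw [h3]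
  field_simp

end

end ThirdOrder

end

theorem lemma2p6 (l : ℝ) (hl : 0 < l) (q : ℝ → ℝ)
    (hq : MeasureTheory.MemLp q 2 (MeasureTheory.volume.restrict (Set.Ioo 0 l))) :
    ThirdOrder.aConst q l ≠ 0 ∧ ‖ThirdOrder.theta0 q l‖ = 1 ∧
    ∀ θ : ℂ, ‖θ‖ = 1 → θ + ThirdOrder.theta0 q l ≠ 0 →
      ∃ μ : ℤ → ℝ,
        ThirdOrder.IsAscendingEnumeration (ThirdOrder.realZeros q l θ) μ ∧
        ∀ lam : ℂ,
          Multipliable (fun n : ℤ => 1 - lam ^ 3 / (μ n : ℂ) ^ 3) ∧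
          ThirdOrder.charFun q l θ lam =
            -ThirdOrder.aConst q l * (θ + ThirdOrder.theta0 q l) *
              ∏' n : ℤ, (1 - lam ^ 3 / (μ n : ℂ) ^ 3) := by
  have ha : ThirdOrder.aConst q l ≠ 0 := by
    rw [ThirdOrder.aConst_eq hl.le hq]
    exact_mod_cast ThirdOrder.specEnd_ofReal_ne_zero hl hq 0
  refine ⟨ha, ?_, fun θ hθ hne => ?_⟩
  · rw [ThirdOrder.theta0, norm_div, RCLike.norm_conj, div_self (norm_ne_zero_iff.2 ha)]
  · rw [← ThirdOrder.specFun_zero hl hq θ]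
    refine ThirdOrder.exists_enumeration_and_product hl hq hθ ?_
    rw [ThirdOrder.specFun_zero hl hq θ]
    exact mul_ne_zero (neg_ne_zero.2 ha) hne
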